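/- For a transcendental entire function $f$ write $M(r)=\max_{|z|=r}|f(z)|$, and for $r>0$ let $C(r)=\{z:|z|=r\}$; for $0<r_1<r_2$ let $\overline A(r_1,r_2)=\{z:r_1\le |z|\le r_2\}$. A continuum is a nonempty compact connected subset of $\mathbb C$. If $\Gamma$ is a continuum such that all zeros of $f$ lie in the unbounded component of $\mathbb C\setminus\Gamma$, and $z_0,z_0'$ are distinct points of $\Gamma$, then $$\Delta\!\arg(f(\Gamma);z_0,z_0')=\operatorname{Im} g(z_0')-\operatorname{Im} g(z_0),$$ where $G\supset\Gamma$ is any simply connected domain containing no zeros of $f$ and $g$ is any branch of $\log f$ in $G$ (the value does not depend on the choice of $G$ and $g$). **Theorem.** Let $f$ be a transcendental entire function of the form $$f(z)=cz^{p_0}\prod_{n=1}^{\infty}\left(1+\frac{z}{a_n}\right)^{p_n},$$ where $c\in\mathbb R\setminus\{0\}$, $p_n\in\{0,1,\ldots\}$ for $n\ge 0$, and the sequence $(a_n)_{n\ge1}$ is positive and strictly increasing. Let $R_1>0$ be a constant such that $M(r^s)\ge M(r)^s$ for all $r\ge R_1$ and $s>1$. Let $t$ and $a$ be positive numbers such that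 $$t\ge R_1,\qquad t^{a/4}\ge\frac{48\sqrt2}{\pi}\qquad\text{and}\qquad a\,t^{a/4}\ge\frac{384\sqrt2}{\pi}.$$ If $\gamma$ is any continuum in $\{z:\operatorname{Im} z\ge0\}$ that meets both $C(t)$ and $C(t^{1+a})$, with $$\frac1{M(t)}<|f(z)|<M(t)\quad\text{for } z\in\gamma,$$ then there exist a continuum $\Gamma\subset\gamma\cap\overline A(t,t^{1+a})$ and distinct points $z_0,z_0'\in\Gamma$ such that all zeros of $f$ lie in the unbounded component of $\mathbb C\setminus\Gamma$ and $$\Delta\!\arg(f(\Gamma);z_0,z_0')\ge\frac{\pi^2t^{a/4}\log M(t)}{48\sqrt2\,\log t}.$$ -/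

import Mathlib

/-- A transcendental entire function: holomorphic on the whole plane and not a polynomial. -/
def IsTranscendentalEntire (f : ℂ → ℂ) : Prop :=
  Differentiable ℂ f ∧ ¬ ∃ P : Polynomial ℂ, ∀ z : ℂ, f z = P.eval z

/-- `f z = c * z ^ p₀ * ∏ (1 + z / a_n) ^ p_n` as a convergent infinite product: at every point
the partial products converge to `f z`.  (The factors are indexed from `0`.) -/
def HasProductForm (f : ℂ → ℂ) (c : ℝ) (p₀ : ℕ) (p : ℕ → ℕ) (a : ℕ → ℝ) : Prop :=
  ∀ z : ℂ, Filter.Tendsto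
    (fun N : ℕ => (c : ℂ) * z ^ p₀ * ∏ n ∈ Finset.range N, (1 + z / (a n : ℂ)) ^ p n)
    Filter.atTop (nhds (f z))

/-- The maximum modulus `M(r) = max_{|z| = r} |f z|`. -/
noncomputable def maxModulus (f : ℂ → ℂ) (r : ℝ) : ℝ :=
  sSup ((fun z : ℂ => ‖f z‖) '' Metric.sphere (0 : ℂ) r)

/-- `R₁ > 0` is a constant for which `M(r ^ c) ≥ M(r) ^ c` for all `r ≥ R₁` and `c > 1`. -/
def IsHadamardConstant (f : ℂ → ℂ) (R₁ : ℝ) : Prop :=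
  0 < R₁ ∧ ∀ r : ℝ, R₁ ≤ r → ∀ c : ℝ, 1 < c → maxModulus f r ^ c ≤ maxModulus f (r ^ c)

/-- A plane continuum: a (nonempty) compact connected set. -/
def IsContinuum (K : Set ℂ) : Prop :=
  IsCompact K ∧ IsConnected K

/-- The closed annulus `{z : r₁ ≤ |z| ≤ r₂}`. -/
def closedAnnulus (r₁ r₂ : ℝ) : Set ℂ :=
  {z : ℂ | r₁ ≤ ‖z‖ ∧ ‖z‖ ≤ r₂}

/-- All the zeros of `f` lie in the unbounded component of the complement of `K`. -/
def ZerosInUnboundedComponent (f : ℂ → ℂ) (K : Set ℂ) : Prop :=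
  ∀ w : ℂ, f w = 0 → ¬ Bornology.IsBounded (connectedComponentIn Kᶜ w)

/-- The net change `Δarg (f(K); z₀, z₀')` of the argument of `f z` as `z` traverses `K` from `z₀`
to `z₀'` is defined and equals `δ`: the points are distinct points of `K`, all zeros of `f` lie in
the unbounded complementary component of `K`, and `δ = Im g(z₀') - Im g(z₀)`, where `g` is a branch
of `log f` in a simply connected domain `G` that contains `K` but no zeros of `f`.
For connected `K` the value does not depend on `G` and `g`, see `HasNetArgChange.unique`. -/
def HasNetArgChange (f : ℂ → ℂ) (K : Set ℂ) (z₀ z₀' : ℂ) (δ : ℝ) : Prop :=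
  z₀ ∈ K ∧ z₀' ∈ K ∧ z₀ ≠ z₀' ∧ ZerosInUnboundedComponent f K ∧
    ∃ (G : Set ℂ) (g : ℂ → ℂ), IsOpen G ∧ IsSimplyConnected G ∧ K ⊆ G ∧
      (∀ z ∈ G, f z ≠ 0) ∧ DifferentiableOn ℂ g G ∧ (∀ z ∈ G, Complex.exp (g z) = f z) ∧
      δ = (g z₀').im - (g z₀).im

theorem HasNetArgChange.unique {f : ℂ → ℂ} {K : Set ℂ} (hK : IsConnected K) {z₀ z₀' : ℂ}
    {δ₁ δ₂ : ℝ} (h₁ : HasNetArgChange f K z₀ z₀' δ₁) (h₂ : HasNetArgChange f K z₀ z₀' δ₂) :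
    δ₁ = δ₂ := by
  obtain ⟨hz, hz', -, -, G₁, g₁, -, -, hK₁, -, hd₁, he₁, rfl⟩ := h₁
  obtain ⟨-, -, -, -, G₂, g₂, -, -, hK₂, -, hd₂, he₂, rfl⟩ := h₂
  have hc : ContinuousOn (fun z => ((g₁ z).im - (g₂ z).im) / (2 * Real.pi)) K := by
    have c₁ := hd₁.continuousOn.mono hK₁
    have c₂ := hd₂.continuousOn.mono hK₂
    exact ((Complex.continuous_im.comp_continuousOn c₁).sub
      (Complex.continuous_im.comp_continuousOn c₂)).div_const _
  have hm : Set.MapsTo (fun z => ((g₁ z).im - (g₂ z).im) / (2 * Real.pi)) K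
      (Set.range ((↑) : ℤ → ℝ)) := by
    intro z hzK
    have h : Complex.exp (g₁ z) = Complex.exp (g₂ z) := by
      rw [he₁ z (hK₁ hzK), he₂ z (hK₂ hzK)]
    obtain ⟨n, hn⟩ := Complex.exp_eq_exp_iff_exists_int.1 h
    refine ⟨n, ?_⟩
    have hi := congrArg Complex.im hn
    simp at hi
    have := Real.pi_pos
    simp only
    rw [hi]
    field_simp
    ring
  have hdisc : IsDiscrete (Set.range ((↑) : ℤ → ℝ)) :=
    Int.isClosedEmbedding_coe_real.isEmbedding.isDiscrete_range
  have := hK.isPreconnected.constant_of_mapsTo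
    hdisc hc hm hz hz'
  have hpi := Real.pi_pos
  field_simp at this
  linarith

/-!
The zeros of `f` are real and nonpositive, so on the closed upper half-plane `log f` has a branch
whose imaginary part, up to a constant, is the sum `argSum` of the arguments of the factors of the
product. Its change is estimated between a point `z₀` of `Γ` on the circle `|z| = t` and a point
`z₁` of `Γ` on the circle `|z| = R`, where `R = t ^ (1 + a)` and `Γ` is a subcontinuum of `γ` that
joins these circles inside the annulus. Put `B = log M(t)`, `D = log M(e ^ 2 * t) - B` and
`K = log M(R) - B`.

* The Hadamard property gives `D ≥ 2 * B / log t`, and comparing factors gives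
  `argSum z₀ ≤ (π / 0.76) * D` (`argSum_le_log_maxModulus_sub`). So the argument at `z₀` is small
  if `D` is.
* On each circle `|f|` is smallest on the negative axis, and `Γ` meets each circle of radius in
  `[t, R]`. Hence `|f| < M(t)` on the segment `[-R, -t]`, and comparison with the harmonic measure
  of the slit disc shows that `K` is at least a multiple of `t ^ (a / 2) * D`
  (`norm_le_of_slit_annulus`).
* Conversely `K ≤ 8 * B + 15 * argSum z₁` (`log_maxModulus_le`). If `z₁` is not close to the negative
  axis, then `log M(R) - log |f z₁|` is at most a multiple of `argSum z₁`. If it is close, the zeros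
  of modulus up to about `R` are counted by `argSum z₁`. The farther zeros make `|f z₁|` small, so
  their contribution to `log M(R)` is bounded because `log |f z₁| > -B`. This uses a comparison with
  a point of `Γ` on a smaller circle whose radius keeps away from the moduli of the zeros; the radius
  comes from the Chebyshev bound for monic polynomials.

Together `argSum z₁` is at least a multiple of `t ^ (a / 2) * D`, up to a multiple of `B`, which the
assumptions on `t` and `a` absorb (`le_sub_of_growth`). The exponent `a / 2` instead of `a / 4`
leaves room for the constants.
-/

/-! ### A logarithm cut along the negative imaginary axis -/

/-- The branch of the logarithm cut along the negative imaginary axis, with imaginary part in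
`(-π/2, 3π/2]`. It agrees with the principal branch on the closed upper half-plane and is
holomorphic across the negative real axis. -/
noncomputable def downLog (w : ℂ) : ℂ :=
  Complex.log (-Complex.I * w) + Real.pi / 2 * Complex.I

theorem exp_downLog {w : ℂ} (hw : w ≠ 0) : Complex.exp (downLog w) = w := by
  rw [downLog, Complex.exp_add, Complex.exp_log (by simpa using hw), Complex.exp_pi_div_two_mul_I]
  linear_combination (-w) * Complex.I_mul_I

theorem downLog_eq_log {w : ℂ} (hw : w ≠ 0) (h : -(Real.pi / 2) < w.arg) :
    downLog w = Complex.log w := by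
  have hI : Complex.log (-Complex.I) = -(Real.pi / 2) * Complex.I := Complex.log_neg_I
  have hmem : (-Complex.I).arg + w.arg ∈ Set.Ioc (-Real.pi) Real.pi := by
    rw [Complex.arg_neg_I]
    constructor <;> linarith [Complex.arg_le_pi w, Real.pi_pos]
  rw [downLog, (Complex.log_mul_eq_add_log_iff (by simp) hw).2 hmem, hI]
  ring

theorem downLog_eq_log_of_im_nonneg {w : ℂ} (hw : w ≠ 0) (h : 0 ≤ w.im) :
    downLog w = Complex.log w :=
  downLog_eq_log hw (by linarith [Complex.arg_nonneg_iff.2 h, Real.pi_pos])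

theorem norm_downLog_one_add_le {w : ℂ} (hw : ‖w‖ ≤ 1 / 2) :
    ‖downLog (1 + w)‖ ≤ 3 / 2 * ‖w‖ := by
  have harg := (Complex.arg_one_add_mem_Ioo (z := w) (by linarith)).1
  have hne : 1 + w ≠ 0 := by
    intro h
    have h1 : w = -1 := by linear_combination h
    rw [h1] at hw
    norm_num at hw
  rw [downLog_eq_log hne harg]
  exact Complex.norm_log_one_add_half_le_self hw

theorem differentiableAt_downLog {w : ℂ} (hw : ∀ y : ℝ, 0 ≤ y → w + y * Complex.I ≠ 0) :
    DifferentiableAt ℂ downLog w := by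
  have hs : -Complex.I * w ∈ Complex.slitPlane := by
    rw [Complex.mem_slitPlane_iff]
    by_contra! h
    have h1 : w.im ≤ 0 := by simpa using h.1
    have h2 : w.re = 0 := by simpa using h.2
    refine hw (-w.im) (by linarith) (Complex.ext ?_ ?_) <;> simp [h2]
  unfold downLog
  exact ((differentiableAt_id.const_mul _).clog hs).add_const _

/-! ### A branch of the logarithm of the product -/

section Product

variable {f : ℂ → ℂ} {c : ℝ} {p₀ : ℕ} {p : ℕ → ℕ} {α : ℕ → ℝ}

theorem HasProductForm.summable (hc : c ≠ 0) (hα : ∀ n, 0 < α n)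
    (h : HasProductForm f c p₀ p α) : Summable fun n => (p n : ℝ) / α n := by
  have h1 := h 1
  have h2 : Filter.Tendsto (fun N : ℕ => |c| * ∏ n ∈ Finset.range N, (1 + 1 / α n) ^ p n)
      Filter.atTop (nhds ‖f 1‖) := by
    refine h1.norm.congr fun N => ?_
    rw [one_pow, mul_one, norm_mul, norm_prod, Complex.norm_real, Real.norm_eq_abs]
    congr 1
    refine Finset.prod_congr rfl fun n _ => ?_
    rw [norm_pow]
    congr 1
    have : (1 + 1 / (α n : ℂ)) = ((1 + 1 / α n : ℝ) : ℂ) := by push_cast; ring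
    rw [this, Complex.norm_real, Real.norm_eq_abs, abs_of_pos]
    have := hα n
    positivity
  obtain ⟨B, hB⟩ := h2.bddAbove_range
  refine summable_of_sum_range_le (c := B / |c|)
    (fun n => div_nonneg (Nat.cast_nonneg _) (hα n).le) fun N => ?_
  have hcpos : 0 < |c| := abs_pos.2 hc
  rw [le_div_iff₀ hcpos, mul_comm]
  have hBN : |c| * ∏ n ∈ Finset.range N, (1 + 1 / α n) ^ p n ≤ B := hB ⟨N, rfl⟩
  refine le_trans (mul_le_mul_of_nonneg_left ?_ hcpos.le) hBN
  have key : ∀ M : ℕ, 1 + ∑ n ∈ Finset.range M, (p n : ℝ) / α n ≤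
      ∏ n ∈ Finset.range M, (1 + 1 / α n) ^ p n := by
    intro M
    induction M with
    | zero => simp
    | succ M ih =>
      rw [Finset.sum_range_succ, Finset.prod_range_succ]
      have hα' := hα M
      have hb : 1 + (p M : ℝ) * (1 / α M) ≤ (1 + 1 / α M) ^ p M :=
        one_add_mul_le_pow (by have : 0 < 1 / α M := by positivity
                               linarith) _
      have hs : 0 ≤ ∑ n ∈ Finset.range M, (p n : ℝ) / α n :=
        Finset.sum_nonneg fun n _ => div_nonneg (Nat.cast_nonneg _) (hα n).le
      have hq : 0 ≤ (p M : ℝ) * (1 / α M) := by positivity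
      calc 1 + (∑ n ∈ Finset.range M, (p n : ℝ) / α n + p M / α M)
          ≤ (1 + ∑ n ∈ Finset.range M, (p n : ℝ) / α n) * (1 + p M * (1 / α M)) := by
            rw [div_eq_mul_one_div]
            nlinarith
        _ ≤ _ := mul_le_mul ih hb (by linarith) (by linarith)
  linarith [key N]

theorem finite_setOf_le (hα : ∀ n, 0 < α n) (hs : Summable fun n => (p n : ℝ) / α n) (K : ℝ) :
    {n | p n ≠ 0 ∧ α n ≤ K}.Finite := by
  rcases le_or_gt K 0 with hK | hK
  · refine Set.Finite.subset Set.finite_empty fun n hn => ?_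
    exact absurd hn.2 (by linarith [hα n])
  have h := hs.tendsto_cofinite_zero.eventually (gt_mem_nhds (show (0 : ℝ) < 1 / K by positivity))
  refine Set.Finite.subset (Filter.eventually_cofinite.1 h) fun n hn => ?_
  have h1 : (1 : ℝ) ≤ p n := by exact_mod_cast Nat.one_le_iff_ne_zero.2 hn.1
  have := hα n
  simp only [Set.mem_ofPred_eq, not_lt]
  rw [div_le_div_iff₀ hK this]
  nlinarith [hn.2]

theorem norm_mul_downLog_le (hα : ∀ n, 0 < α n) {K : ℝ} {z : ℂ}
    (hz : ‖z‖ ≤ K) {n : ℕ} (hn : n ∉ {n | p n ≠ 0 ∧ α n ≤ 2 * K}) :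
    ‖(p n : ℂ) * downLog (1 + z / α n)‖ ≤ 3 / 2 * K * (p n / α n) := by
  have hn' := hα n
  by_cases hp : p n = 0
  · simp [hp]
  have hK : 2 * K < α n := by
    by_contra! h
    exact hn ⟨hp, h⟩
  have hnorm : ‖z / (α n : ℂ)‖ = ‖z‖ / α n := by
    rw [norm_div, Complex.norm_real, Real.norm_eq_abs, abs_of_pos hn']
  have h1 : ‖z / (α n : ℂ)‖ ≤ 1 / 2 := by
    rw [hnorm, div_le_iff₀ hn']
    linarith
  rw [norm_mul, Complex.norm_natCast]
  calc (p n : ℝ) * ‖downLog (1 + z / α n)‖ ≤ p n * (3 / 2 * (‖z‖ / α n)) := by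
        rw [← hnorm]
        exact mul_le_mul_of_nonneg_left (norm_downLog_one_add_le h1) (Nat.cast_nonneg _)
    _ ≤ p n * (3 / 2 * (K / α n)) := by gcongr
    _ = _ := by ring

theorem summable_mul_downLog (hα : ∀ n, 0 < α n) (hs : Summable fun n => (p n : ℝ) / α n)
    (z : ℂ) : Summable fun n => (p n : ℂ) * downLog (1 + z / α n) := by
  refine Summable.of_norm_bounded_eventually (g := fun n => 3 / 2 * ‖z‖ * (p n / α n))
    (hs.mul_left _) ?_
  rw [Filter.eventually_cofinite]
  refine (finite_setOf_le hα hs (2 * ‖z‖)).subset fun n hn => ?_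
  by_contra h
  exact hn (norm_mul_downLog_le hα le_rfl h)

/-- A branch of `log f`, for `f` given by its product, holomorphic off the vertical rays that go
down from the zeros of `f`. -/
noncomputable def logBranch (c : ℝ) (p₀ : ℕ) (p : ℕ → ℕ) (α : ℕ → ℝ) (z : ℂ) : ℂ :=
  Complex.log c + p₀ * downLog z + ∑' n, (p n : ℂ) * downLog (1 + z / α n)

/-- The argument of `f / c` on the closed upper half-plane, given by the arguments in `[0, π]` of
the factors of the product. -/
noncomputable def argSum (p₀ : ℕ) (p : ℕ → ℕ) (α : ℕ → ℝ) (z : ℂ) : ℝ :=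
  p₀ * z.arg + ∑' n, (p n : ℝ) * (1 + z / α n).arg

theorem exp_logBranch_of_factors_ne_zero (hc : c ≠ 0) (hα : ∀ n, 0 < α n)
    (h : HasProductForm f c p₀ p α) {z : ℂ} (hz₀ : p₀ ≠ 0 → z ≠ 0)
    (hz : ∀ n, p n ≠ 0 → 1 + z / α n ≠ 0) :
    Complex.exp (logBranch c p₀ p α z) = f z := by
  have key : ∀ (k : ℕ) (w : ℂ), (k ≠ 0 → w ≠ 0) → Complex.exp (k * downLog w) = w ^ k := by
    intro k w hw
    rcases eq_or_ne k 0 with rfl | hk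
    · simp
    · rw [Complex.exp_nat_mul, exp_downLog (hw hk)]
  have hsum := (summable_mul_downLog hα (h.summable hc hα) z).hasSum.tendsto_sum_nat
  have h1 := (Complex.continuous_exp.tendsto _).comp
    (hsum.const_add (Complex.log c + p₀ * downLog z))
  refine tendsto_nhds_unique h1 ((h z).congr fun N => ?_)
  simp only [Function.comp_apply]
  rw [Complex.exp_add, Complex.exp_add, Complex.exp_log (by exact_mod_cast hc), key _ _ hz₀,
    Complex.exp_sum]
  congr 1
  exact Finset.prod_congr rfl fun n _ => (key _ _ (hz n)).symm

theorem HasProductForm.factors_ne_zero (h : HasProductForm f c p₀ p α) {z : ℂ} (hz : f z ≠ 0) :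
    (p₀ ≠ 0 → z ≠ 0) ∧ ∀ n, p n ≠ 0 → 1 + z / α n ≠ 0 := by
  constructor
  · rintro hp rfl
    refine hz (tendsto_nhds_unique (h 0) ?_)
    simp [hp]
  · intro n hp h0
    refine hz (tendsto_nhds_unique (h z) (tendsto_const_nhds.congr' ?_))
    filter_upwards [Filter.eventually_gt_atTop n] with N hN
    rw [Finset.prod_eq_zero (Finset.mem_range.2 hN), mul_zero]
    rw [h0, zero_pow hp]

theorem exp_logBranch (hc : c ≠ 0) (hα : ∀ n, 0 < α n) (h : HasProductForm f c p₀ p α) {z : ℂ}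
    (hz : f z ≠ 0) : Complex.exp (logBranch c p₀ p α z) = f z :=
  exp_logBranch_of_factors_ne_zero hc hα h (h.factors_ne_zero hz).1 (h.factors_ne_zero hz).2

/-- All zeros of the product are real and nonpositive. -/
theorem HasProductForm.zero_real (hc : c ≠ 0) (hα : ∀ n, 0 < α n)
    (h : HasProductForm f c p₀ p α) {z : ℂ} (hz : f z = 0) : z.im = 0 ∧ z.re ≤ 0 := by
  by_contra hne
  refine Complex.exp_ne_zero _ ((exp_logBranch_of_factors_ne_zero hc hα h ?_ ?_).trans hz)
  · rintro - rfl
    exact hne (by simp)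
  · intro n _ h0
    have hn := hα n
    have hz' : z = ((-α n : ℝ) : ℂ) := by
      have : (α n : ℂ) ≠ 0 := by exact_mod_cast hn.ne'
      field_simp at h0
      push_cast
      linear_combination h0
    refine hne ?_
    rw [hz']
    exact ⟨Complex.ofReal_im _, by rw [Complex.ofReal_re]; linarith⟩

theorem differentiableAt_logBranch (hc : c ≠ 0) (hα : ∀ n, 0 < α n)
    (h : HasProductForm f c p₀ p α) {z : ℂ}
    (hz : ∀ y : ℝ, 0 ≤ y → f (z + y * Complex.I) ≠ 0) :
    DifferentiableAt ℂ (logBranch c p₀ p α) z := by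
  have hs := h.summable hc hα
  set K : ℝ := ‖z‖ + 1 with hK
  have hfin := finite_setOf_le hα hs (2 * K)
  set S : Finset ℕ := hfin.toFinset with hS
  have hterm : ∀ n, DifferentiableAt ℂ (fun w : ℂ => (p n : ℂ) * downLog (1 + w / α n)) z := by
    intro n
    by_cases hp : p n = 0
    · simp [hp]
    have hn := hα n
    have h1 : DifferentiableAt ℂ downLog (1 + z / α n) := by
      refine differentiableAt_downLog fun y hy h0 => ?_
      refine (h.factors_ne_zero (hz (α n * y) (by positivity))).2 n hp ?_
      rw [← h0]
      have : (α n : ℂ) ≠ 0 := by exact_mod_cast hn.ne'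
      push_cast
      field_simp
      ring
    have h2 : DifferentiableAt ℂ (fun w : ℂ => 1 + w / (α n : ℂ)) z := by fun_prop
    exact (DifferentiableAt.comp z h1 h2).const_mul _
  have hsplit : logBranch c p₀ p α = fun w => Complex.log c + p₀ * downLog w +
      (∑ n ∈ S, (p n : ℂ) * downLog (1 + w / α n) +
        ∑' n : {n // n ∉ S}, (p n : ℂ) * downLog (1 + w / α n)) := by
    funext w
    rw [logBranch, (summable_mul_downLog hα hs w).sum_add_tsum_subtype_compl S]
  have htail : DifferentiableOn ℂ (fun w => ∑' n : {n // n ∉ S},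
      (p n : ℂ) * downLog (1 + w / α n)) (Metric.ball 0 K) := by
    refine Complex.differentiableOn_tsum_of_summable_norm
      (u := fun n : {n // n ∉ S} => 3 / 2 * K * (p n / α n))
      ((hs.subtype _).mul_left _) ?_ Metric.isOpen_ball ?_
    · rintro ⟨n, hn⟩ w hw
      have hw' : ‖w‖ < K := by simpa using hw
      by_cases hp : p n = 0
      · simp only [hp, Nat.cast_zero, zero_mul]
        exact differentiableWithinAt_const _
      have hKn : 2 * K < α n := by
        by_contra! hle
        exact hn (by simp [hS, hp, hle])
      have hn := hα n
      have h1 : DifferentiableAt ℂ downLog (1 + w / α n) := by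
        refine differentiableAt_downLog fun y hy h0 => ?_
        have hre := congrArg Complex.re h0
        have h3 : (w / (α n : ℂ)).re = w.re / α n := Complex.div_ofReal_re _ _
        simp [h3] at hre
        have h4 := (abs_le.1 (Complex.abs_re_le_norm w)).1
        have h5 : w.re / α n = -1 := by linarith
        rw [div_eq_iff hn.ne'] at h5
        linarith [norm_nonneg w]
      have h2 : DifferentiableAt ℂ (fun w : ℂ => 1 + w / (α n : ℂ)) w := by fun_prop
      exact ((DifferentiableAt.comp w h1 h2).const_mul _).differentiableWithinAt
    · rintro ⟨n, hn⟩ w hw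
      have hw' : ‖w‖ < K := by simpa using hw
      exact norm_mul_downLog_le hα hw'.le (by simpa [hS] using hn)
  have hp₀ : DifferentiableAt ℂ (fun w => (p₀ : ℂ) * downLog w) z := by
    rcases eq_or_ne p₀ 0 with h0 | h0
    · simp [h0]
    · exact (differentiableAt_downLog fun y hy =>
        (h.factors_ne_zero (hz y hy)).1 h0).const_mul _
  rw [hsplit]
  refine (hp₀.const_add _).add (DifferentiableAt.add ?_ ?_)
  · exact DifferentiableAt.fun_sum fun n _ => hterm n
  · exact htail.differentiableAt (Metric.isOpen_ball.mem_nhds (by simp [hK]))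

/-- On the closed upper half-plane the modulus and the argument of `f` are the sums of those of the
factors. The terms with `p n = 0` vanish, so that their factors need no attention. -/
theorem hasSum_log_norm_and_arg (hc : c ≠ 0) (hα : ∀ n, 0 < α n) (h : HasProductForm f c p₀ p α)
    {z : ℂ} (hz0 : z ≠ 0) (hz : f z ≠ 0) (him : 0 ≤ z.im) :
    HasSum (fun n => (p n : ℝ) * Real.log ‖1 + z / α n‖)
      (Real.log ‖f z‖ - Real.log |c| - p₀ * Real.log ‖z‖) ∧
    HasSum (fun n => (p n : ℝ) * (1 + z / α n).arg) (argSum p₀ p α z - p₀ * z.arg) ∧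
    (logBranch c p₀ p α z).im = (Complex.log c).im + argSum p₀ p α z := by
  have hsum := (summable_mul_downLog hα (h.summable hc hα) z).hasSum
  have hterm : ∀ n, (p n : ℂ) * downLog (1 + z / α n) =
      (p n : ℂ) * Complex.log (1 + z / α n) := by
    intro n
    by_cases hp : p n = 0
    · simp [hp]
    have him' : 0 ≤ (1 + z / (α n : ℂ)).im := by
      rw [Complex.add_im, Complex.div_ofReal_im, Complex.one_im, zero_add]
      exact div_nonneg him (hα n).le
    rw [downLog_eq_log_of_im_nonneg ((h.factors_ne_zero hz).2 n hp) him']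
  have hre : ∀ n, ((p n : ℂ) * downLog (1 + z / α n)).re = p n * Real.log ‖1 + z / α n‖ := by
    intro n
    rw [hterm, ← Complex.ofReal_natCast, Complex.re_ofReal_mul, Complex.log_re]
  have himt : ∀ n, ((p n : ℂ) * downLog (1 + z / α n)).im = p n * (1 + z / α n).arg := by
    intro n
    rw [hterm, ← Complex.ofReal_natCast, Complex.im_ofReal_mul, Complex.log_im]
  have hsre := Complex.hasSum_re hsum
  have hsim := Complex.hasSum_im hsum
  simp only [hre] at hsre
  simp only [himt] at hsim
  have hz' : downLog z = Complex.log z := downLog_eq_log_of_im_nonneg hz0 him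
  have hexp := congrArg (fun w => Real.log ‖w‖) (exp_logBranch hc hα h hz)
  simp only [Complex.norm_exp, Real.log_exp] at hexp
  have e1 : (logBranch c p₀ p α z).re = Real.log |c| + p₀ * Real.log ‖z‖ +
      (∑' n, (p n : ℂ) * downLog (1 + z / α n)).re := by
    rw [logBranch, hz', Complex.add_re, Complex.add_re, Complex.log_re, Complex.norm_real,
      Real.norm_eq_abs, ← Complex.ofReal_natCast, Complex.re_ofReal_mul, Complex.log_re]
  have e2 : (logBranch c p₀ p α z).im = (Complex.log c).im + (p₀ * z.arg +
      (∑' n, (p n : ℂ) * downLog (1 + z / α n)).im) := by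
    rw [logBranch, hz', Complex.add_im, Complex.add_im, ← Complex.ofReal_natCast,
      Complex.im_ofReal_mul, Complex.log_im z, add_assoc]
  refine ⟨?_, ?_, ?_⟩
  · rw [show Real.log ‖f z‖ - Real.log |c| - p₀ * Real.log ‖z‖ =
      (∑' n, (p n : ℂ) * downLog (1 + z / α n)).re by rw [← hexp, e1]; ring]
    exact hsre
  · rw [argSum, hsim.tsum_eq, add_sub_cancel_left]
    exact hsim
  · rw [e2, argSum, hsim.tsum_eq]

/-- The maximum modulus is attained on the positive real axis. -/
theorem HasProductForm.maxModulus_eq (hα : ∀ n, 0 < α n) (h : HasProductForm f c p₀ p α) {r : ℝ}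
    (hr : 0 ≤ r) : maxModulus f r = ‖f r‖ := by
  refine IsGreatest.csSup_eq ⟨⟨r, by simp [abs_of_nonneg hr], rfl⟩, ?_⟩
  rintro _ ⟨z, hz, rfl⟩
  have hz' : ‖z‖ = r := by simpa using hz
  refine le_of_tendsto_of_tendsto' (h z).norm (h r).norm fun N => ?_
  simp only [norm_mul, norm_pow, norm_prod]
  have hr' : ‖(r : ℂ)‖ = r := by rw [Complex.norm_real, Real.norm_eq_abs, abs_of_nonneg hr]
  rw [hz', hr']
  refine mul_le_mul_of_nonneg_left ?_ (by positivity)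
  refine Finset.prod_le_prod (fun n _ => by positivity) fun n _ => ?_
  refine pow_le_pow_left₀ (norm_nonneg _) ?_ _
  have hn := hα n
  have e : (1 + (r : ℂ) / (α n : ℂ)) = ((1 + r / α n : ℝ) : ℂ) := by push_cast; ring
  rw [e, Complex.norm_real, Real.norm_eq_abs, abs_of_pos (by positivity)]
  refine (norm_add_le _ _).trans ?_
  rw [norm_one, norm_div, hz', Complex.norm_real, Real.norm_eq_abs, abs_of_pos hn]

/-- On each circle, `|f|` is smallest on the negative real axis. -/
theorem HasProductForm.norm_neg_le (hα : ∀ n, 0 < α n) (h : HasProductForm f c p₀ p α) (z : ℂ) :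
    ‖f (-(‖z‖ : ℝ))‖ ≤ ‖f z‖ := by
  refine le_of_tendsto_of_tendsto' (h _).norm (h z).norm fun N => ?_
  simp only [norm_mul, norm_pow, norm_prod, norm_neg, Complex.norm_real, norm_norm]
  refine mul_le_mul_of_nonneg_left ?_ (by positivity)
  refine Finset.prod_le_prod (fun n _ => by positivity) fun n _ => ?_
  refine pow_le_pow_left₀ (norm_nonneg _) ?_ _
  have hn := hα n
  have e : (1 + -(‖z‖ : ℂ) / (α n : ℂ)) = ((1 - ‖z‖ / α n : ℝ) : ℂ) := by push_cast; ring
  rw [e, Complex.norm_real, Real.norm_eq_abs]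
  have hnz : ‖z‖ / α n = ‖-(z / (α n : ℂ))‖ := by
    rw [norm_neg, norm_div, Complex.norm_real, Real.norm_eq_abs, abs_of_pos hn]
  have := abs_norm_sub_norm_le (1 : ℂ) (-(z / (α n : ℂ)))
  rwa [norm_one, sub_neg_eq_add, ← hnz] at this

end Product

/-! ### Estimates for a single factor -/

theorem im_div_norm_one_add_le_arg {ζ : ℂ} (him : 0 ≤ ζ.im) :
    ζ.im / ‖1 + ζ‖ ≤ (1 + ζ).arg := by
  have h0 : 0 ≤ (1 + ζ).arg := Complex.arg_nonneg_iff.2 (by simpa using him)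
  have h1 := Real.sin_le h0
  rw [Complex.sin_arg] at h1
  simpa using h1

theorem norm_one_add_sq (ζ : ℂ) : ‖1 + ζ‖ ^ 2 = 1 + 2 * ζ.re + ‖ζ‖ ^ 2 := by
  rw [Complex.sq_norm, Complex.sq_norm, Complex.normSq_apply, Complex.normSq_apply]
  simp
  ring

theorem arg_one_add_le {ζ : ℂ} (him : 0 ≤ ζ.im) (hζ : ‖ζ‖ ≤ 1) :
    (1 + ζ).arg ≤ Real.pi * ‖ζ‖ := by
  have h0 : 0 ≤ (1 + ζ).arg := Complex.arg_nonneg_iff.2 (by simpa using him)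
  have hre : 0 ≤ (1 + ζ).re := by
    have := (abs_le.1 (Complex.abs_re_le_norm ζ)).1
    simp
    linarith
  have h1 : (1 + ζ).arg ≤ Real.pi / 2 :=
    (abs_le.1 (Complex.abs_arg_le_pi_div_two_iff.2 hre)).2
  have h2 := Real.mul_le_sin h0 h1
  rw [Complex.sin_arg] at h2
  have h3 : (1 + ζ).im / ‖1 + ζ‖ ≤ ‖ζ‖ := by
    refine div_le_of_le_mul₀ (norm_nonneg _) (norm_nonneg _) ?_
    refine abs_le_of_sq_le_sq' ?_ (by positivity) |>.2
    rw [mul_pow, norm_one_add_sq]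
    have h4 : ‖ζ‖ ^ 2 = ζ.re ^ 2 + ζ.im ^ 2 := by
      rw [Complex.sq_norm, Complex.normSq_apply]
      ring
    have h5 : (1 + ζ).im = ζ.im := by simp
    rw [h5]
    nlinarith [sq_nonneg (ζ.re + ‖ζ‖ ^ 2)]
  have hpi := Real.pi_pos
  have h6 := h2.trans h3
  rw [div_mul_eq_mul_div, div_le_iff₀ hpi] at h6
  nlinarith [norm_nonneg ζ]

/-- The argument of a factor is controlled by the growth of its modulus along the positive axis. -/
theorem arg_one_add_le_log_sub_log {ζ : ℂ} (him : 0 ≤ ζ.im) {q : ℝ} (hq : 7.38 ≤ q) :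
    0.76 * (1 + ζ).arg ≤ Real.pi * (Real.log (1 + q * ‖ζ‖) - Real.log (1 + ‖ζ‖)) := by
  set s := ‖ζ‖ with hs
  have hs0 : 0 ≤ s := norm_nonneg _
  have hpi := Real.pi_pos
  have h1 : 0 < 1 + s := by linarith
  have h2 : 0 < 1 + q * s := by positivity
  have hlog : s * (q - 1) / (1 + q * s) ≤ Real.log (1 + q * s) - Real.log (1 + s) := by
    have := Real.log_le_sub_one_of_pos (show 0 < (1 + s) / (1 + q * s) by positivity)
    rw [Real.log_div h1.ne' h2.ne'] at this
    have e : s * (q - 1) / (1 + q * s) = 1 - (1 + s) / (1 + q * s) := by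
      field_simp
      ring
    linarith
  have hlin : (1 + ζ).arg ≤ Real.pi * min s 1 := by
    rcases le_total s 1 with h | h
    · rw [min_eq_left h]
      exact arg_one_add_le him h
    · rw [min_eq_right h, mul_one]
      exact Complex.arg_le_pi _
  have hmin : 0.76 * min s 1 ≤ s * (q - 1) / (1 + q * s) := by
    rw [le_div_iff₀ h2]
    rcases le_total s 1 with h | h
    · rw [min_eq_left h]
      nlinarith [mul_nonneg hs0 (sub_nonneg.2 h), mul_nonneg (mul_nonneg hs0 (sub_nonneg.2 h))
        (show 0 ≤ q by linarith)]
    · rw [min_eq_right h]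
      nlinarith [mul_nonneg (sub_nonneg.2 h) (show 0 ≤ q - 7.38 by linarith)]
  calc 0.76 * (1 + ζ).arg ≤ 0.76 * (Real.pi * min s 1) := by gcongr
    _ = Real.pi * (0.76 * min s 1) := by ring
    _ ≤ _ := by gcongr; exact hmin.trans hlog

/-- Away from the negative axis, the loss of `log |1 + ζ|` against its value on the positive axis is
controlled by the argument. -/
theorem log_sub_log_le_arg {ζ : ℂ} (him : 0 ≤ ζ.im) (hne : 1 + ζ ≠ 0) {T : ℝ} (hT : 0 ≤ T)
    (h : ‖ζ‖ - ζ.re ≤ T * ζ.im) :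
    Real.log (1 + ‖ζ‖) - Real.log ‖1 + ζ‖ ≤ T * (1 + ζ).arg := by
  set s := ‖ζ‖ with hs
  have hs0 : 0 ≤ s := norm_nonneg _
  have hn : 0 < ‖1 + ζ‖ := norm_pos_iff.2 hne
  have h1 : 0 < 1 + s := by linarith
  have hle : ‖1 + ζ‖ ≤ 1 + s := by simpa using norm_add_le (1 : ℂ) ζ
  have hsinh := Real.self_le_sinh_iff.2 (sub_nonneg.2 (Real.log_le_log hn hle))
  rw [Real.sinh_eq, neg_sub, Real.exp_sub, Real.exp_sub, Real.exp_log h1, Real.exp_log hn] at hsinh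
  have e : ((1 + s) / ‖1 + ζ‖ - ‖1 + ζ‖ / (1 + s)) / 2 = (s - ζ.re) / ((1 + s) * ‖1 + ζ‖) := by
    field_simp
    linear_combination -norm_one_add_sq ζ
  rw [e] at hsinh
  have h0 : 0 ≤ s - ζ.re := by linarith [Complex.re_le_norm ζ]
  calc _ ≤ (s - ζ.re) / ((1 + s) * ‖1 + ζ‖) := hsinh
    _ ≤ (s - ζ.re) / ‖1 + ζ‖ := by
      gcongr
      nlinarith
    _ ≤ T * ζ.im / ‖1 + ζ‖ := by gcongr
    _ = T * (ζ.im / ‖1 + ζ‖) := by ring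
    _ ≤ _ := by gcongr; exact im_div_norm_one_add_le_arg him

theorem pi_div_two_le_arg {w : ℂ} (hre : w.re ≤ 0) (him : 0 ≤ w.im) (hw : w ≠ 0) :
    Real.pi / 2 ≤ w.arg := by
  by_contra! h
  have h1 : |w.arg| < Real.pi / 2 := by
    rwa [abs_of_nonneg (Complex.arg_nonneg_iff.2 him)]
  rcases Complex.abs_arg_lt_pi_div_two_iff.1 h1 with h2 | h2
  · linarith
  · exact hw h2

/-- For a zero far out, the loss of `log |1 + ζ₂|` near the negative axis outweighs both the gain on
the positive axis and the loss at a point `ζ₁` on a ten times smaller circle. -/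
theorem log_combination_nonpos {ζ₁ ζ₂ : ℂ} (h₁ : ‖ζ₁‖ ≤ ‖ζ₂‖ / 10) (h₂ : ‖ζ₂‖ ≤ 20 / 19)
    (hre : ζ₂.re ≤ -(19 / 20) * ‖ζ₂‖) (hne : 1 + ζ₂ ≠ 0) :
    Real.log (1 + ‖ζ₂‖) - 5 * Real.log ‖1 + ζ₁‖ + 4 * Real.log ‖1 + ζ₂‖ ≤ 0 := by
  set s := ‖ζ₂‖ with hs
  have hs0 : 0 ≤ s := norm_nonneg _
  have ha : Real.log (1 + s) ≤ s := by
    linarith [Real.log_le_sub_one_of_pos (show 0 < 1 + s by linarith)]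
  have hb : -(s / 10 * (190 / 170)) ≤ Real.log ‖1 + ζ₁‖ := by
    have hlow : 1 - s / 10 ≤ ‖1 + ζ₁‖ := by
      have := norm_sub_norm_le (1 : ℂ) (-ζ₁)
      rw [norm_one, norm_neg, sub_neg_eq_add] at this
      linarith
    have hpos : 0 < 1 - s / 10 := by linarith
    have h3 := Real.log_le_log hpos hlow
    have h4 := Real.one_sub_inv_le_log_of_pos hpos
    have h5 : (1 - s / 10)⁻¹ ≤ 1 + s / 10 * (190 / 170) := by
      rw [inv_le_iff_one_le_mul₀ hpos]
      nlinarith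
    linarith
  have hd : Real.log ‖1 + ζ₂‖ ≤ -(8 / 19) * s := by
    have hpos : 0 < ‖1 + ζ₂‖ := norm_pos_iff.2 hne
    have h3 := Real.log_le_sub_one_of_pos (show 0 < ‖1 + ζ₂‖ ^ 2 by positivity)
    rw [Real.log_pow, norm_one_add_sq, ← hs] at h3
    push_cast at h3
    nlinarith
  linarith

/-! ### Monic polynomials are somewhere large on an interval -/

open Polynomial in
/-- A consequence of the extremal property of the Chebyshev polynomials. -/
theorem Polynomial.Monic.exists_pow_le_abs_eval {Q : ℝ[X]} (hQ : Q.Monic) (m : ℝ) {h : ℝ}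
    (hh : 0 < h) : ∃ x, |x - m| ≤ h ∧ (h / 2) ^ Q.natDegree ≤ |Q.eval x| := by
  by_contra! hcon
  set n := Q.natDegree with hn
  have hn0 : n ≠ 0 := by
    intro h0
    have h1 := hcon m (by simpa using hh.le)
    rw [hQ.natDegree_eq_zero.1 h0, h0] at h1
    simp at h1
  set ε := (h / 2) ^ n with hε
  have hε0 : 0 < ε := by positivity
  have hlin : (C h * X + C m : ℝ[X]).natDegree = 1 := natDegree_linear hh.ne'
  have hlc : (C h * X + C m : ℝ[X]).leadingCoeff = h := leadingCoeff_linear hh.ne'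
  have hcomp : (Q.comp (C h * X + C m)).leadingCoeff = h ^ n := by
    rw [leadingCoeff_comp (by rw [hlin]; exact one_ne_zero), hQ.leadingCoeff, hlc, one_mul]
  have key := Polynomial.Chebyshev.leadingCoeff_le_of_forall_abs_le_one (n := n)
    (P := C ε⁻¹ * Q.comp (C h * X + C m)) ?_ ?_
  · rw [leadingCoeff_mul, leadingCoeff_C, hcomp, hε, div_pow, inv_div, div_mul_cancel₀] at key
    · have : (2 : ℝ) ^ (n - 1) < 2 ^ n := pow_lt_pow_right₀ (by norm_num) (by omega)
      linarith
    · positivity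
  · refine degree_le_of_natDegree_le ((natDegree_C_mul_le _ _).trans ?_)
    rw [natDegree_comp, hlin, mul_one]
  · intro x hx
    have h1 := hcon (h * x + m) (by
      rw [add_sub_cancel_right, abs_mul, abs_of_pos hh]
      have : |x| ≤ 1 := abs_le.2 hx
      nlinarith)
    simp only [eval_mul, eval_C, eval_comp, eval_add, eval_X, abs_mul, abs_inv]
    rw [abs_of_pos hε0, inv_mul_le_iff₀ hε0, mul_one]
    exact h1.le

/-! ### Growth of the modulus against growth of the argument -/

section Growth

variable {f : ℂ → ℂ} {c : ℝ} {p₀ : ℕ} {p : ℕ → ℕ} {α : ℕ → ℝ}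

theorem HasProductForm.ne_zero_of_pos (hc : c ≠ 0) (hα : ∀ n, 0 < α n)
    (h : HasProductForm f c p₀ p α) {r : ℝ} (hr : 0 < r) : f r ≠ 0 := by
  intro h0
  have := (h.zero_real hc hα h0).2
  rw [Complex.ofReal_re] at this
  linarith

theorem HasProductForm.maxModulus_pos (hc : c ≠ 0) (hα : ∀ n, 0 < α n)
    (h : HasProductForm f c p₀ p α) {r : ℝ} (hr : 0 < r) : 0 < maxModulus f r := by
  rw [h.maxModulus_eq hα hr.le]
  exact norm_pos_iff.2 (h.ne_zero_of_pos hc hα hr)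

theorem norm_div_ofReal_of_pos {a : ℝ} (ha : 0 < a) (z : ℂ) : ‖z / (a : ℂ)‖ = ‖z‖ / a := by
  rw [norm_div, Complex.norm_real, Real.norm_eq_abs, abs_of_pos ha]

theorem norm_one_add_ofReal_div {a r : ℝ} (ha : 0 < a) (hr : 0 ≤ r) :
    ‖1 + (r : ℂ) / (a : ℂ)‖ = 1 + r / a := by
  have e : (1 + (r : ℂ) / (a : ℂ)) = ((1 + r / a : ℝ) : ℂ) := by push_cast; ring
  rw [e, Complex.norm_real, Real.norm_eq_abs, abs_of_pos (by positivity)]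

theorem im_div_ofReal_nonneg {a : ℝ} (ha : 0 < a) {z : ℂ} (him : 0 ≤ z.im) :
    0 ≤ (z / (a : ℂ)).im := by
  rw [Complex.div_ofReal_im]
  exact div_nonneg him ha.le

theorem hasSum_log_maxModulus (hc : c ≠ 0) (hα : ∀ n, 0 < α n) (h : HasProductForm f c p₀ p α)
    {r : ℝ} (hr : 0 < r) :
    HasSum (fun n => (p n : ℝ) * Real.log (1 + r / α n))
      (Real.log (maxModulus f r) - Real.log |c| - p₀ * Real.log r) := by
  have hsum := (hasSum_log_norm_and_arg hc hα h (z := r) (by exact_mod_cast hr.ne')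
    (h.ne_zero_of_pos hc hα hr) (by simp)).1
  rw [← h.maxModulus_eq hα hr.le, Complex.norm_real, Real.norm_eq_abs, abs_of_pos hr] at hsum
  exact hsum.congr_fun fun n => by rw [norm_one_add_ofReal_div (hα n) hr.le]

/-- The argument on a circle is controlled by the growth of the maximum modulus beyond it. -/
theorem argSum_le_log_maxModulus_sub (hc : c ≠ 0) (hα : ∀ n, 0 < α n)
    (h : HasProductForm f c p₀ p α) {z : ℂ} (hz0 : z ≠ 0) (hz : f z ≠ 0) (him : 0 ≤ z.im) {q : ℝ}
    (hq : 7.38 ≤ q) (hq1 : 1 ≤ Real.log q) :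
    0.76 * argSum p₀ p α z ≤
      Real.pi * (Real.log (maxModulus f (q * ‖z‖)) - Real.log (maxModulus f ‖z‖)) := by
  have hr : 0 < ‖z‖ := norm_pos_iff.2 hz0
  have hq0 : 0 < q := by linarith
  have h1 := hasSum_log_maxModulus hc hα h hr
  have h2 := hasSum_log_maxModulus hc hα h (show 0 < q * ‖z‖ by positivity)
  have h3 := (hasSum_log_norm_and_arg hc hα h hz0 hz him).2.1
  have hle := hasSum_le (fun n => ?_) (h3.mul_left 0.76) ((h2.sub h1).mul_left Real.pi)
  · rw [Real.log_mul hq0.ne' hr.ne'] at hle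
    have hp : 0.76 * ((p₀ : ℝ) * z.arg) ≤ Real.pi * (p₀ * Real.log q) := by
      have e1 : (p₀ : ℝ) * z.arg ≤ p₀ * Real.pi :=
        mul_le_mul_of_nonneg_left (Complex.arg_le_pi z) (Nat.cast_nonneg _)
      have e2 : (p₀ : ℝ) * 1 ≤ p₀ * Real.log q :=
        mul_le_mul_of_nonneg_left hq1 (Nat.cast_nonneg _)
      nlinarith [Real.pi_pos, Real.pi_pos.le, (Nat.cast_nonneg p₀ : (0 : ℝ) ≤ p₀),
        mul_le_mul_of_nonneg_left e2 Real.pi_pos.le]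
    linarith
  · have hn := hα n
    have := arg_one_add_le_log_sub_log (im_div_ofReal_nonneg hn him) hq
    rw [norm_div_ofReal_of_pos hn, ← mul_div_assoc] at this
    have := mul_le_mul_of_nonneg_left this (Nat.cast_nonneg (p n) : (0 : ℝ) ≤ p n)
    linarith

/-- Away from the negative axis, `log |f|` falls short of its maximum on the circle by no more than
a multiple of the argument. -/
theorem log_maxModulus_sub_le_argSum (hc : c ≠ 0) (hα : ∀ n, 0 < α n)
    (h : HasProductForm f c p₀ p α) {z : ℂ} (hz0 : z ≠ 0) (hz : f z ≠ 0) (him : 0 ≤ z.im) {T : ℝ}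
    (hT : 0 ≤ T) (hTz : ‖z‖ - z.re ≤ T * z.im) :
    Real.log (maxModulus f ‖z‖) - Real.log ‖f z‖ ≤ T * argSum p₀ p α z := by
  have hr : 0 < ‖z‖ := norm_pos_iff.2 hz0
  have h1 := hasSum_log_maxModulus hc hα h hr
  obtain ⟨h2, h3, -⟩ := hasSum_log_norm_and_arg hc hα h hz0 hz him
  have hle := hasSum_le (fun n => ?_) (h1.sub h2) (h3.mul_left T)
  · have hp : 0 ≤ T * ((p₀ : ℝ) * z.arg) :=
      mul_nonneg hT (mul_nonneg (Nat.cast_nonneg _) (Complex.arg_nonneg_iff.2 him))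
    linarith
  · have hn := hα n
    by_cases hp : p n = 0
    · simp [hp]
    have := log_sub_log_le_arg (im_div_ofReal_nonneg hn him) ((h.factors_ne_zero hz).2 n hp) hT (by
      rw [norm_div_ofReal_of_pos hn, Complex.div_ofReal_re, Complex.div_ofReal_im, ← sub_div,
        ← mul_div_assoc]
      gcongr)
    rw [norm_div_ofReal_of_pos hn] at this
    have := mul_le_mul_of_nonneg_left this (Nat.cast_nonneg (p n) : (0 : ℝ) ≤ p n)
    linarith

theorem log_combination_le_of_near {a R : ℝ} (ha : 0 < a) (haR : a ≤ R) {z₁ z₂ : ℂ}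
    (hz₁ : a ≠ ‖z₁‖) (hz₂ : ‖z₂‖ = R) (hne : 1 + z₂ / (a : ℂ) ≠ 0) :
    Real.log (1 + R / a) - 5 * Real.log ‖1 + z₁ / (a : ℂ)‖ + 4 * Real.log ‖1 + z₂ / (a : ℂ)‖ ≤
      5 * (Real.log (2 * R) - Real.log |‖z₁‖ - a|) := by
  have hR : 0 < R := ha.trans_le haR
  have hsub : 0 < |‖z₁‖ - a| := abs_pos.2 (sub_ne_zero.2 hz₁.symm)
  have h1 : Real.log (1 + R / a) ≤ Real.log (2 * R) - Real.log a := by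
    rw [← Real.log_div (by positivity) ha.ne']
    refine Real.log_le_log (by positivity) ?_
    rw [le_div_iff₀ ha, add_mul, div_mul_cancel₀ _ ha.ne']
    linarith
  have h2 : Real.log ‖1 + z₂ / (a : ℂ)‖ ≤ Real.log (1 + R / a) := by
    refine Real.log_le_log (norm_pos_iff.2 hne) ((norm_add_le _ _).trans ?_)
    rw [norm_one, norm_div_ofReal_of_pos ha, hz₂]
  have h3 : Real.log |‖z₁‖ - a| - Real.log a ≤ Real.log ‖1 + z₁ / (a : ℂ)‖ := by
    rw [← Real.log_div hsub.ne' ha.ne']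
    refine Real.log_le_log (by positivity) ?_
    have h4 := abs_norm_sub_norm_le (z₁ / (a : ℂ)) (-1)
    rw [norm_neg, norm_one, norm_div_ofReal_of_pos ha, sub_neg_eq_add, add_comm _ (1 : ℂ)] at h4
    rwa [show ‖z₁‖ / a - 1 = (‖z₁‖ - a) / a by field_simp, abs_div, abs_of_pos ha] at h4
  linarith

open Polynomial in
/-- If `|f|` is not small at a point `z₂` near the negative axis and is at most `e ^ B` at some point
of each circle of radius in `[t, ‖z₂‖]`, then the maximum modulus is bounded in terms of `B` and the argument of
`f z₂`: the zeros of modulus up to `19 / 20 * ‖z₂‖` are counted by the argument, and the farther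
ones cannot be numerous because `z₂` is close to them. -/
theorem log_maxModulus_le_of_near_neg_axis (hc : c ≠ 0) (hα : ∀ n, 0 < α n)
    (h : HasProductForm f c p₀ p α) {R t B : ℝ} (ht : 0 < t) (htR : 110 * t ≤ R) {z₂ : ℂ}
    (hz₂ : ‖z₂‖ = R) (him : 0 ≤ z₂.im) (hre : z₂.re ≤ -(19 / 20) * R) (hf₂ : f z₂ ≠ 0)
    (hB₂ : -B ≤ Real.log ‖f z₂‖)
    (hB : ∀ ρ ∈ Set.Icc t R, ∃ z, ‖z‖ = ρ ∧ 0 ≤ z.im ∧ f z ≠ 0 ∧ Real.log ‖f z‖ ≤ B) :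
    Real.log (maxModulus f R) ≤ 9 * B + 15 * argSum p₀ p α z₂ := by
  have hR : 0 < R := by linarith
  have hs := h.summable hc hα
  have hfin := finite_setOf_le hα hs (19 / 20 * R)
  set S : Finset ℕ := hfin.toFinset with hS
  have hmem : ∀ n, n ∈ S ↔ p n ≠ 0 ∧ α n ≤ 19 / 20 * R := by
    intro n
    simp [hS]
  set Q : ℝ[X] := X ^ p₀ * ∏ n ∈ S, (X - C (α n)) ^ p n with hQdef
  have hQ : Q.Monic :=
    (monic_X_pow p₀).mul (monic_prod_of_monic _ _ fun n _ => (monic_X_sub_C _).pow _)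
  have hdeg : Q.natDegree = p₀ + ∑ n ∈ S, p n := by
    rw [hQdef, Monic.natDegree_mul (monic_X_pow p₀)
      (monic_prod_of_monic _ _ fun n _ => (monic_X_sub_C _).pow _), natDegree_X_pow,
      natDegree_prod_of_monic _ _ fun n _ => (monic_X_sub_C _).pow _]
    congr 1
    exact Finset.sum_congr rfl fun n _ => by
      rw [(monic_X_sub_C (α n)).natDegree_pow, natDegree_X_sub_C, mul_one]
  set ν : ℝ := p₀ + ∑ n ∈ S, (p n : ℝ) with hν
  have hν' : (Q.natDegree : ℝ) = ν := by rw [hdeg, hν]; push_cast; ring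
  -- A radius in `[t, R / 10]` that stays away from the moduli of the zeros.
  obtain ⟨ρ, hρ, hQρ⟩ := hQ.exists_pow_le_abs_eval ((R / 10 + t) / 2)
    (show 0 < (R / 10 - t) / 2 by linarith)
  rw [abs_le] at hρ
  have hρt : t ≤ ρ := by linarith
  have hρR : ρ ≤ R / 10 := by linarith
  have hρ0 : 0 < ρ := by linarith
  have hQρ' : (R / 44) ^ Q.natDegree ≤ |Q.eval ρ| := by
    refine le_trans (pow_le_pow_left₀ (by positivity) ?_ _) hQρ
    linarith
  have hQpos : 0 < |Q.eval ρ| := lt_of_lt_of_le (by positivity) hQρ'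
  have heval : Q.eval ρ = ρ ^ p₀ * ∏ n ∈ S, (ρ - α n) ^ p n := by
    simp [hQdef, eval_prod]
  have hne : ∀ n ∈ S, ρ - α n ≠ 0 := by
    intro n hn h0
    rw [heval, Finset.prod_eq_zero hn (by rw [h0, zero_pow ((hmem n).1 hn).1])] at hQpos
    simp at hQpos
  have hlogQ : ν * Real.log (R / 44) ≤
      p₀ * Real.log ρ + ∑ n ∈ S, (p n : ℝ) * Real.log |ρ - α n| := by
    have h1 := Real.log_le_log (by positivity) hQρ'
    rw [Real.log_pow, hν', heval, abs_mul, Finset.abs_prod, abs_pow, abs_of_pos hρ0,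
      Real.log_mul (by positivity)
        (Finset.prod_ne_zero_iff.2 fun n hn => abs_ne_zero.2 (pow_ne_zero _ (hne n hn))),
      Real.log_prod (fun n hn => abs_ne_zero.2 (pow_ne_zero _ (hne n hn))), Real.log_pow] at h1
    refine h1.trans_eq ?_
    congr 1
    exact Finset.sum_congr rfl fun n _ => by rw [abs_pow, Real.log_pow]
  obtain ⟨z₁, hz₁, him₁, hf₁, hB₁⟩ := hB ρ ⟨hρt, by linarith⟩
  have hz₁0 : z₁ ≠ 0 := norm_pos_iff.1 (hz₁ ▸ hρ0)
  have hz₂0 : z₂ ≠ 0 := norm_pos_iff.1 (hz₂ ▸ hR)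
  have h1 := (hasSum_log_norm_and_arg hc hα h hz₁0 hf₁ him₁).1
  obtain ⟨h2, h3, -⟩ := hasSum_log_norm_and_arg hc hα h hz₂0 hf₂ him
  have h0 := hasSum_log_maxModulus hc hα h hR
  have hS1 : HasSum (fun n => if n ∈ S then
      (p n : ℝ) * (5 * (Real.log (2 * R) - Real.log |ρ - α n|)) else 0)
      (∑ n ∈ S, (p n : ℝ) * (5 * (Real.log (2 * R) - Real.log |ρ - α n|))) := by
    have := hasSum_sum_of_ne_finset_zero (L := .unconditional ℕ) (f := fun n => if n ∈ S then
      (p n : ℝ) * (5 * (Real.log (2 * R) - Real.log |ρ - α n|)) else 0) (s := S)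
      (fun n hn => if_neg hn)
    rwa [Finset.sum_congr rfl fun n hn => if_pos hn] at this
  have hcomb := hasSum_le (fun n => ?_) ((h0.sub (h1.mul_left 5)).add (h2.mul_left 4)) hS1
  · rw [hz₁, hz₂] at hcomb
    -- The zeros of modulus up to `19 / 20 * R`, with multiplicity, are counted by the argument.
    have hcount : ν * (Real.pi / 2) ≤ argSum p₀ p α z₂ := by
      have hre0 : z₂.re ≤ 0 := by linarith
      have hpart := sum_le_hasSum S (fun n _ => mul_nonneg (Nat.cast_nonneg (p n))
        (Complex.arg_nonneg_iff.2 (by simpa using im_div_ofReal_nonneg (hα n) him))) h3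
      have hSle : ∑ n ∈ S, (p n : ℝ) * (Real.pi / 2) ≤
          argSum p₀ p α z₂ - p₀ * z₂.arg := by
        refine le_trans (Finset.sum_le_sum fun n hn => ?_) hpart
        · refine mul_le_mul_of_nonneg_left ?_ (Nat.cast_nonneg _)
          have hn' := (hmem n).1 hn
          refine pi_div_two_le_arg ?_ ?_ ((h.factors_ne_zero hf₂).2 n hn'.1)
          · rw [Complex.add_re, Complex.div_ofReal_re, Complex.one_re]
            have : z₂.re / α n ≤ -1 := by
              rw [div_le_iff₀ (hα n)]
              linarith
            linarith
          · simpa using im_div_ofReal_nonneg (hα n) him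
      rw [← Finset.sum_mul] at hSle
      have := mul_le_mul_of_nonneg_left (pi_div_two_le_arg hre0 him hz₂0)
        (Nat.cast_nonneg p₀ : (0 : ℝ) ≤ p₀)
      rw [hν, add_mul]
      linarith
    have hsumS : ∑ n ∈ S, (p n : ℝ) * (5 * (Real.log (2 * R) - Real.log |ρ - α n|)) =
        5 * ((∑ n ∈ S, (p n : ℝ)) * Real.log (2 * R) -
          ∑ n ∈ S, (p n : ℝ) * Real.log |ρ - α n|) := by
      rw [Finset.sum_mul, ← Finset.sum_sub_distrib, Finset.mul_sum]
      exact Finset.sum_congr rfl fun n _ => by ring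
    rw [hsumS] at hcomb
    have hlog2 : (p₀ : ℝ) * Real.log R ≤ p₀ * Real.log (2 * R) :=
      mul_le_mul_of_nonneg_left (Real.log_le_log hR (by linarith)) (Nat.cast_nonneg _)
    have hlog88 : Real.log (2 * R) - Real.log (R / 44) ≤ 4.5 := by
      rw [← Real.log_div (by positivity) (by positivity)]
      have e : 2 * R / (R / 44) = 88 := by field_simp; norm_num
      rw [e]
      have h9 : Real.log ((88 : ℝ) ^ 2) ≤ 9 := by
        rw [Real.log_le_iff_le_exp (by norm_num)]
        have h10 : Real.exp 9 = Real.exp 1 ^ 9 := by rw [← Real.exp_nat_mul]; norm_num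
        rw [h10]
        calc (88 : ℝ) ^ 2 ≤ 2.718 ^ 9 := by norm_num
          _ ≤ Real.exp 1 ^ 9 :=
            pow_le_pow_left₀ (by norm_num) (by linarith [Real.exp_one_gt_d9]) _
      rw [Real.log_pow] at h9
      push_cast at h9
      linarith
    have hν0 : 0 ≤ ν := by positivity
    have hνlog : ν * Real.log (2 * R) - ν * Real.log (R / 44) ≤ ν * 4.5 := by
      rw [← mul_sub]
      exact mul_le_mul_of_nonneg_left hlog88 hν0
    have hνpi : ν * 3.14 ≤ ν * Real.pi :=
      mul_le_mul_of_nonneg_left Real.pi_gt_d2.le hν0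
    have hexp : ν * Real.log (2 * R) =
      p₀ * Real.log (2 * R) + (∑ n ∈ S, (p n : ℝ)) * Real.log (2 * R) := by
      rw [hν]
      ring
    linarith
  · by_cases hp : p n = 0
    · simp [hp]
    have hn := hα n
    have hne₂ := (h.factors_ne_zero hf₂).2 n hp
    have hfac : (p n : ℝ) * Real.log (1 + R / α n) - 5 * ((p n : ℝ) * Real.log ‖1 + z₁ / α n‖) +
        4 * ((p n : ℝ) * Real.log ‖1 + z₂ / α n‖) = p n * (Real.log (1 + R / α n) -
          5 * Real.log ‖1 + z₁ / α n‖ + 4 * Real.log ‖1 + z₂ / α n‖) := by ring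
    simp only [hfac]
    split_ifs with hnS
    · refine mul_le_mul_of_nonneg_left ?_ (Nat.cast_nonneg _)
      have := log_combination_le_of_near hn (z₁ := z₁) (by linarith [((hmem n).1 hnS).2])
        (fun h0 => hne n hnS (by rw [h0, hz₁, sub_self])) hz₂ hne₂
      rwa [hz₁] at this
    · refine mul_nonpos_of_nonneg_of_nonpos (Nat.cast_nonneg _) ?_
      have hfar : 19 / 20 * R < α n := by
        by_contra! hle
        exact hnS ((hmem n).2 ⟨hp, hle⟩)
      have hnorm : ‖z₂ / (α n : ℂ)‖ = R / α n := by rw [norm_div_ofReal_of_pos hn, hz₂]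
      have := log_combination_nonpos (ζ₁ := z₁ / α n) (ζ₂ := z₂ / α n) ?_ ?_ ?_ hne₂
      · rwa [hnorm] at this
      · rw [hnorm, norm_div_ofReal_of_pos hn, hz₁, div_div, mul_comm, ← div_div]
        gcongr
      · rw [hnorm, div_le_iff₀ hn]
        linarith
      · rw [hnorm, Complex.div_ofReal_re, ← mul_div_assoc]
        gcongr

/-- The maximum modulus is bounded in terms of the argument at any point of the circle where `|f|` is
not small, if `|f|` is at most `e ^ B` at some point of each circle of radius in `[t, R]`. -/
theorem log_maxModulus_le (hc : c ≠ 0) (hα : ∀ n, 0 < α n)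
    (h : HasProductForm f c p₀ p α) {R t B : ℝ} (ht : 0 < t) (htR : 110 * t ≤ R) (hB0 : 0 ≤ B)
    {z₂ : ℂ} (hz₂ : ‖z₂‖ = R) (him : 0 ≤ z₂.im) (hf₂ : f z₂ ≠ 0)
    (hB₂ : |Real.log ‖f z₂‖| ≤ B)
    (hB : ∀ ρ ∈ Set.Icc t R, ∃ z, ‖z‖ = ρ ∧ 0 ≤ z.im ∧ f z ≠ 0 ∧ Real.log ‖f z‖ ≤ B) :
    Real.log (maxModulus f R) ≤ 9 * B + 15 * argSum p₀ p α z₂ := by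
  rw [abs_le] at hB₂
  rcases le_total z₂.re (-(19 / 20) * R) with hre | hre
  · exact log_maxModulus_le_of_near_neg_axis hc hα h ht htR hz₂ him hre hf₂ hB₂.1 hB
  · have hR : 0 < R := by linarith
    have hz₂0 : z₂ ≠ 0 := norm_pos_iff.1 (hz₂ ▸ hR)
    have hsq : R ^ 2 = z₂.re ^ 2 + z₂.im ^ 2 := by
      rw [← hz₂, Complex.sq_norm, Complex.normSq_apply]
      ring
    have hle : z₂.re ≤ R := hz₂ ▸ Complex.re_le_norm z₂
    -- `(R - re z₂) ^ 2 * (R + re z₂) = (im z₂) ^ 2 * (R - re z₂)`, and `39 ≤ 15 ^ 2`.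
    have key := log_maxModulus_sub_le_argSum hc hα h hz₂0 hf₂ him (T := 15) (by norm_num) (by
      rw [hz₂]
      refine abs_le_of_sq_le_sq' ?_ (by positivity) |>.2
      nlinarith [mul_nonneg (sub_nonneg.2 hle) (show 0 ≤ z₂.re + 19 / 20 * R by linarith)])
    rw [hz₂] at key
    linarith

end Growth

/-! ### A Milloux-type estimate in a slit disc -/

theorem re_arctan (w : ℂ) :
    (Complex.arctan w).re = ((1 + w * Complex.I) / (1 - w * Complex.I)).arg / 2 := by
  rw [Complex.arctan, ← Complex.log_im]
  simp
  ring

theorem one_add_div_one_sub_mul_I (w : ℂ) :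
    ((1 + w * Complex.I) / (1 - w * Complex.I)).re =
      (1 - ‖w‖ ^ 2) / ((1 + w.im) ^ 2 + w.re ^ 2) ∧
    ((1 + w * Complex.I) / (1 - w * Complex.I)).im =
      2 * w.re / ((1 + w.im) ^ 2 + w.re ^ 2) := by
  have hN : Complex.normSq (1 - w * Complex.I) = (1 + w.im) ^ 2 + w.re ^ 2 := by
    rw [Complex.normSq_apply]
    simp
    ring
  rw [Complex.div_re, Complex.div_im, hN, Complex.sq_norm, Complex.normSq_apply]
  simp only [Complex.add_re, Complex.add_im, Complex.sub_re, Complex.sub_im, Complex.one_re,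
    Complex.one_im, Complex.mul_I_re, Complex.mul_I_im]
  constructor <;> ring

theorem differentiableAt_arctan {w : ℂ} (hw : 0 < w.re) :
    DifferentiableAt ℂ Complex.arctan w := by
  have hs : (1 + w * Complex.I) / (1 - w * Complex.I) ∈ Complex.slitPlane := by
    refine Complex.mem_slitPlane_iff.2 (Or.inr ?_)
    rw [(one_add_div_one_sub_mul_I w).2]
    positivity
  have hne : 1 - w * Complex.I ≠ 0 := by
    intro h
    have := congrArg Complex.im h
    simp at this
    linarith
  have h1 : DifferentiableAt ℂ (fun w : ℂ => (1 + w * Complex.I) / (1 - w * Complex.I)) w := by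
    fun_prop (disch := exact hne)
  unfold Complex.arctan
  exact (h1.clog hs).const_mul _

/-- For the slit disc `{|z| < R} \ (-∞, 0]`, a holomorphic function whose real part is the harmonic
measure of the circle `|z| = R`, namely `4 / π * arctan √(z / R)`. -/
theorem exists_harmonicMeasure_slitDisc {R : ℝ} (hR : 0 < R) : ∃ Ψ : ℂ → ℂ,
    (∀ z ∈ Complex.slitPlane, ‖z‖ ≤ R → DifferentiableAt ℂ Ψ z ∧ 0 ≤ (Ψ z).re) ∧
    (∀ z ∈ Complex.slitPlane, ‖z‖ = R → (Ψ z).re = 1) ∧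
    ∀ r : ℝ, 0 < r → (Ψ r).re ≤ 4 / Real.pi * Real.sqrt (r / R) := by
  have hpi := Real.pi_pos
  set W : ℂ → ℂ := fun z => Complex.exp (Complex.log (z / R) / 2) with hW
  have hnorm : ∀ z : ℂ, ‖z / (R : ℂ)‖ = ‖z‖ / R := norm_div_ofReal_of_pos hR
  have hslit : ∀ z ∈ Complex.slitPlane, z / (R : ℂ) ∈ Complex.slitPlane := by
    intro z hz
    rw [Complex.mem_slitPlane_iff] at hz ⊢
    rw [Complex.div_ofReal_re, Complex.div_ofReal_im]
    exact hz.imp (fun h => div_pos h hR) fun h => div_ne_zero h hR.ne'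
  have hWre : ∀ z ∈ Complex.slitPlane, 0 < (W z).re := by
    intro z hz
    obtain ⟨h1, -⟩ := Complex.mem_slitPlane_iff_arg.1 (hslit z hz)
    rw [hW, Complex.exp_re]
    refine mul_pos (Real.exp_pos _) (Real.cos_pos_of_mem_Ioo ?_)
    have e : (Complex.log (z / R) / 2).im = (z / (R : ℂ)).arg / 2 := by
      rw [← Complex.log_im, Complex.div_ofNat_im]
    rw [e]
    have h2 := Complex.neg_pi_lt_arg (z / (R : ℂ))
    have h3 := lt_of_le_of_ne (Complex.arg_le_pi (z / (R : ℂ))) h1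
    constructor <;> linarith
  have hWnorm : ∀ z ∈ Complex.slitPlane, ‖W z‖ ^ 2 = ‖z‖ / R := by
    intro z hz
    have hz0 := Complex.slitPlane_ne_zero (hslit z hz)
    rw [hW, ← norm_pow, ← Complex.exp_nat_mul]
    rw [show ((2 : ℕ) : ℂ) * (Complex.log (z / R) / 2) = Complex.log (z / R) by push_cast; ring,
      Complex.exp_log hz0, hnorm]
  refine ⟨fun z => (4 / Real.pi : ℝ) * Complex.arctan (W z), fun z hz hzR => ⟨?_, ?_⟩,
    fun z hz hzR => ?_, fun r hr => ?_⟩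
  · have h1 : DifferentiableAt ℂ W z := by
      have h2 : DifferentiableAt ℂ (fun z : ℂ => z / (R : ℂ)) z := by fun_prop
      exact ((h2.clog (hslit z hz)).div_const 2).cexp
    exact ((differentiableAt_arctan (hWre z hz)).comp z h1).const_mul _
  · rw [Complex.re_ofReal_mul, re_arctan]
    have him : 0 ≤ ((1 + W z * Complex.I) / (1 - W z * Complex.I)).im := by
      rw [(one_add_div_one_sub_mul_I (W z)).2]
      have := hWre z hz
      positivity
    have := Complex.arg_nonneg_iff.2 him
    positivity
  · have hre : ((1 + W z * Complex.I) / (1 - W z * Complex.I)).re = 0 := by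
      rw [(one_add_div_one_sub_mul_I (W z)).1, hWnorm z hz, hzR, div_self hR.ne', sub_self,
        zero_div]
    have him : 0 < ((1 + W z * Complex.I) / (1 - W z * Complex.I)).im := by
      rw [(one_add_div_one_sub_mul_I (W z)).2]
      have := hWre z hz
      positivity
    rw [Complex.re_ofReal_mul, re_arctan, Complex.arg_eq_pi_div_two_iff.2 ⟨hre, him⟩]
    field_simp
    norm_num
  · have hx : 0 < r / R := by positivity
    have e : W r = (Real.sqrt (r / R) : ℝ) := by
      rw [hW, Real.sqrt_eq_rpow, Real.rpow_def_of_pos hx]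
      simp only
      rw [← Complex.ofReal_div, ← Complex.ofReal_log hx.le]
      push_cast
      congr 1
      ring
    rw [Complex.re_ofReal_mul, e, ← Complex.ofReal_arctan, Complex.ofReal_re]
    refine mul_le_mul_of_nonneg_left ?_ (by positivity)
    have hy := Real.arctan_nonneg.2 (Real.sqrt_nonneg (r / R))
    calc Real.arctan √(r / R) ≤ Real.tan (Real.arctan √(r / R)) :=
          Real.le_tan hy (Real.arctan_lt_pi_div_two _)
      _ = √(r / R) := Real.tan_arctan _

/-- If `|f| ≤ M` on the inner circle of an annulus and on its part of the negative axis, then a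
large value of `|f|` on the positive axis forces a much larger maximum on the outer circle. -/
theorem norm_le_of_slit_annulus {f : ℂ → ℂ} (hf : Differentiable ℂ f) {t R M K : ℝ} (ht : 0 < t)
    (hM : 0 < M) (hK : 0 ≤ K) (hinner : ∀ z, ‖z‖ = t → ‖f z‖ ≤ M)
    (houter : ∀ z, ‖z‖ = R → ‖f z‖ ≤ M * Real.exp K)
    (hslit : ∀ ρ ∈ Set.Icc t R, ‖f (-(ρ : ℝ))‖ < M) {r : ℝ} (htr : t < r) (hrR : r < R) :
    ‖f r‖ ≤ M * Real.exp (K * (4 / Real.pi * Real.sqrt (r / R))) := by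
  have hR : 0 < R := by linarith
  have hr : 0 < r := by linarith
  obtain ⟨Ψ, hΨ, hΨR, hΨr⟩ := exists_harmonicMeasure_slitDisc hR
  have hnr : ‖(r : ℂ)‖ = r := by rw [Complex.norm_real, Real.norm_eq_abs, abs_of_pos hr]
  rcases le_or_gt ‖f r‖ M with hle | hgt
  · refine hle.trans (le_mul_of_one_le_right hM.le (Real.one_le_exp ?_))
    have := Real.pi_pos
    positivity
  -- Apply the maximum principle to `f * exp (-K * Ψ)` where `|f| > M`.
  set O : Set ℂ := {z | t < ‖z‖ ∧ ‖z‖ < R ∧ M < ‖f z‖ ∧ z ∈ Complex.slitPlane} with hO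
  have hOopen : IsOpen O := by
    refine (isOpen_lt continuous_const continuous_norm).inter
      ((isOpen_lt continuous_norm continuous_const).inter
      ((isOpen_lt continuous_const hf.continuous.norm).inter Complex.isOpen_slitPlane))
  have hcl : ∀ z ∈ closure O, t ≤ ‖z‖ ∧ ‖z‖ ≤ R ∧ M ≤ ‖f z‖ := by
    have hclosed : IsClosed {z : ℂ | t ≤ ‖z‖ ∧ ‖z‖ ≤ R ∧ M ≤ ‖f z‖} :=
      (isClosed_le continuous_const continuous_norm).inter
        ((isClosed_le continuous_norm continuous_const).inter
        (isClosed_le continuous_const hf.continuous.norm))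
    have hsub : O ⊆ {z : ℂ | t ≤ ‖z‖ ∧ ‖z‖ ≤ R ∧ M ≤ ‖f z‖} :=
      fun w hw => ⟨hw.1.le, hw.2.1.le, hw.2.2.1.le⟩
    exact fun z hz => closure_minimal hsub hclosed hz
  have hclslit : ∀ z ∈ closure O, z ∈ Complex.slitPlane := by
    intro z hz
    obtain ⟨h1, h2, h3⟩ := hcl z hz
    by_contra hns
    rw [Complex.mem_slitPlane_iff] at hns
    push Not at hns
    have hzr : z = ((-‖z‖ : ℝ) : ℂ) := by
      have e1 : ‖z‖ = -z.re := by
        conv_lhs => rw [← Complex.re_add_im z, hns.2]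
        simp [abs_of_nonpos hns.1]
      refine Complex.ext ?_ ?_
      · rw [Complex.ofReal_re, e1, neg_neg]
      · rw [Complex.ofReal_im, hns.2]
    have h4 := hslit ‖z‖ ⟨h1, h2⟩
    rw [← Complex.ofReal_neg, ← hzr] at h4
    linarith
  set F : ℂ → ℂ := fun z => f z * Complex.exp (-(K : ℂ) * Ψ z) with hF
  have hFnorm : ∀ z, ‖F z‖ = ‖f z‖ * Real.exp (-(K * (Ψ z).re)) := by
    intro z
    rw [hF, norm_mul, Complex.norm_exp, ← Complex.ofReal_neg, Complex.re_ofReal_mul, neg_mul]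
  have hFd : DiffContOnCl ℂ F O := by
    refine DifferentiableOn.diffContOnCl fun z hz => ?_
    have h1 := (hΨ z (hclslit z hz) (hcl z hz).2.1).1
    exact ((hf z).mul (h1.const_mul _).cexp).differentiableWithinAt
  have hbd : Bornology.IsBounded O :=
    Metric.isBounded_closedBall.subset (s := O) (t := Metric.closedBall 0 R)
      fun z hz => by simpa using hz.2.1.le
  have hfr : ∀ z ∈ frontier O, ‖F z‖ ≤ M := by
    intro z hz
    rw [hOopen.frontier_eq] at hz
    obtain ⟨hz1, hz2⟩ := hz
    obtain ⟨h1, h2, -⟩ := hcl z hz1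
    have hs := hclslit z hz1
    rw [hFnorm]
    rcases h2.eq_or_lt with h2 | h2
    · rw [hΨR z hs h2, mul_one, Real.exp_neg, ← div_eq_mul_inv, div_le_iff₀ (Real.exp_pos _)]
      exact houter z h2
    · have hfz : ‖f z‖ ≤ M := by
        rcases h1.eq_or_lt with h1 | h1
        · exact hinner z h1.symm
        · by_contra! h3
          exact hz2 ⟨h1, h2, h3, hs⟩
      have h4 : Real.exp (-(K * (Ψ z).re)) ≤ 1 := by
        rw [Real.exp_le_one_iff, neg_nonpos]
        exact mul_nonneg hK (hΨ z hs h2.le).2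
      calc _ ≤ ‖f z‖ * 1 := mul_le_mul_of_nonneg_left h4 (norm_nonneg _)
        _ ≤ M := by rwa [mul_one]
  have hrO : (r : ℂ) ∈ O := by
    refine ⟨by rwa [hnr], by rwa [hnr], hgt, Complex.mem_slitPlane_iff.2 (Or.inl ?_)⟩
    simpa using hr
  have hmax := Complex.norm_le_of_forall_mem_frontier_norm_le hbd hFd hfr (subset_closure hrO)
  rw [hFnorm, Real.exp_neg, ← div_eq_mul_inv, div_le_iff₀ (Real.exp_pos _)] at hmax
  refine hmax.trans (mul_le_mul_of_nonneg_left (Real.exp_le_exp.2 ?_) hM.le)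
  exact mul_le_mul_of_nonneg_left (hΨr r hr) hK

/-! ### Plane topology -/

/-- If a continuous function takes the values `a ≤ b` on a continuum, then a subcontinuum on which the
function stays in `[a, b]` joins the two levels: in a compact space components are intersections of
clopen sets, so otherwise the continuum would split. -/
theorem exists_continuum_between {K : Set ℂ} (hK : IsContinuum K) {φ : ℂ → ℝ} (hφ : Continuous φ)
    {a b : ℝ} (hab : a ≤ b) (ha : ∃ z ∈ K, φ z = a) (hb : ∃ z ∈ K, φ z = b) :
    ∃ Γ, IsContinuum Γ ∧ Γ ⊆ K ∧ (∀ z ∈ Γ, a ≤ φ z ∧ φ z ≤ b) ∧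
      (∃ z ∈ Γ, φ z = a) ∧ ∃ z ∈ Γ, φ z = b := by
  rcases hab.eq_or_lt with rfl | hlt
  · obtain ⟨z, hz, hza⟩ := ha
    exact ⟨{z}, ⟨isCompact_singleton, isConnected_singleton⟩, by simpa using hz,
      by simp [hza], ⟨z, rfl, hza⟩, z, rfl, hza⟩
  set Y : Set ℂ := K ∩ φ ⁻¹' Set.Icc a b with hY
  have hYc : IsCompact Y := hK.1.inter_right (isClosed_Icc.preimage hφ)
  have hYcl : IsClosed Y := hYc.isClosed
  have : CompactSpace Y := isCompact_iff_compactSpace.1 hYc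
  -- It is enough that one component of `Y` meets both levels.
  suffices hcomp : ∃ x : Y, φ x = a ∧ ∃ y ∈ connectedComponent x, φ y = b by
    obtain ⟨x, hx, y, hy, hyb⟩ := hcomp
    refine ⟨Subtype.val '' connectedComponent x, ⟨?_, ?_⟩, ?_, ?_, ⟨x, ?_, hx⟩, y, ?_, hyb⟩
    · exact isClosed_connectedComponent.isCompact.image continuous_subtype_val
    · exact isConnected_connectedComponent.image _ continuous_subtype_val.continuousOn
    · rintro _ ⟨w, -, rfl⟩
      exact w.2.1
    · rintro _ ⟨w, -, rfl⟩
      exact w.2.2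
    · exact ⟨x, mem_connectedComponent, rfl⟩
    · exact ⟨y, hy, rfl⟩
  by_contra! hcon
  set A : Set Y := {x | φ x = a} with hA
  set B : Set Y := {x | φ x = b} with hB
  have hφY : Continuous fun x : Y => φ x := hφ.comp continuous_subtype_val
  have hAc : IsCompact A := (isClosed_eq hφY continuous_const).isCompact
  have hBc : IsCompact B := (isClosed_eq hφY continuous_const).isCompact
  -- Each point of level `a` has a clopen neighbourhood without points of level `b`.
  have hclopen : ∀ x ∈ A, ∃ s : Set Y, IsClopen s ∧ x ∈ s ∧ Disjoint s B := by
    intro x hx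
    have hempty : B ∩ ⋂ s : {s : Set Y // IsClopen s ∧ x ∈ s}, (s : Set Y) = ∅ := by
      rw [← connectedComponent_eq_iInter_isClopen]
      exact Set.eq_empty_of_forall_notMem fun y hy => hcon x hx y hy.2 hy.1
    obtain ⟨T, hT⟩ := hBc.elim_finite_subfamily_closed _ (fun s => s.2.1.isClosed) hempty
    refine ⟨⋂ s ∈ T, (s : Set Y), ?_, ?_, ?_⟩
    · exact isClopen_biInter_finset fun s _ => s.2.1
    · exact Set.mem_iInter₂.2 fun s _ => s.2.2
    · rw [Set.disjoint_iff_inter_eq_empty, Set.inter_comm]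
      exact hT
  choose! s hs hxs hsB using hclopen
  obtain ⟨T, hTA, hT⟩ := hAc.elim_nhds_subcover s fun x hx => (hs x hx).isOpen.mem_nhds (hxs x hx)
  set U : Set Y := ⋃ x ∈ T, s x with hU
  have hUclopen : IsClopen U := isClopen_biUnion_finset fun x hx => hs x (hTA x hx)
  have hUB : Disjoint U B := by
    rw [hU, Set.disjoint_iUnion₂_left]
    exact fun x hx => hsB x (hTA x hx)
  have hU₁ : IsClosed (Subtype.val '' U) :=
    (hUclopen.isClosed.isCompact.image continuous_subtype_val).isClosed
  have hU₂ : IsClosed (Subtype.val '' Uᶜ) :=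
    (hUclopen.compl.isClosed.isCompact.image continuous_subtype_val).isClosed
  -- Then `K` splits into two disjoint closed pieces.
  have hKcl := hK.1.isClosed
  have hpre := isPreconnected_closed_iff.1 hK.2.isPreconnected
    (Subtype.val '' U ∪ (K ∩ φ ⁻¹' Set.Iic a)) (Subtype.val '' Uᶜ ∪ (K ∩ φ ⁻¹' Set.Ici b))
    (hU₁.union (hKcl.inter (isClosed_Iic.preimage hφ)))
    (hU₂.union (hKcl.inter (isClosed_Ici.preimage hφ))) ?_ ?_ ?_
  · obtain ⟨z, -, h1 | h1, h2 | h2⟩ := hpre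
    · obtain ⟨u, hu, rfl⟩ := h1
      obtain ⟨v, hv, huv⟩ := h2
      rw [Subtype.ext huv] at hv
      exact hv hu
    · obtain ⟨u, hu, rfl⟩ := h1
      exact Set.disjoint_left.1 hUB hu (le_antisymm u.2.2.2 h2.2)
    · obtain ⟨v, hv, rfl⟩ := h2
      exact hv (hT (le_antisymm h1.2 v.2.2.1))
    · have e1 : φ z ≤ a := h1.2
      have e2 : b ≤ φ z := h2.2
      linarith
  · intro z hz
    rcases le_total (φ z) a with h1 | h1
    · exact Or.inl (Or.inr ⟨hz, h1⟩)
    rcases le_total b (φ z) with h2 | h2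
    · exact Or.inr (Or.inr ⟨hz, h2⟩)
    by_cases hu : (⟨z, hz, h1, h2⟩ : Y) ∈ U
    · exact Or.inl (Or.inl ⟨_, hu, rfl⟩)
    · exact Or.inr (Or.inl ⟨_, hu, rfl⟩)
  · obtain ⟨z, hz, hza⟩ := ha
    exact ⟨z, hz, Or.inr ⟨hz, hza.le⟩⟩
  · obtain ⟨z, hz, hzb⟩ := hb
    exact ⟨z, hz, Or.inr ⟨hz, hzb.ge⟩⟩

/-- The region above the graph of a continuous function is simply connected, as the image of the
upper half-plane under a shear. -/
theorem isSimplyConnected_above_graph {h : ℝ → ℝ} (hh : Continuous h) :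
    IsSimplyConnected {z : ℂ | h z.re < z.im} := by
  let e : ℂ ≃ₜ ℂ :=
    { toFun := fun z => z - (h z.re : ℂ) * Complex.I
      invFun := fun z => z + (h z.re : ℂ) * Complex.I
      left_inv := fun z => by simp
      right_inv := fun z => by simp
      continuous_toFun := by fun_prop
      continuous_invFun := by fun_prop }
  have hhalf : IsSimplyConnected {z : ℂ | 0 < z.im} := by
    have hc : Convex ℝ {z : ℂ | 0 < z.im} := convex_halfSpace_im_gt 0
    have : ContractibleSpace {z : ℂ | 0 < z.im} := hc.contractibleSpace ⟨Complex.I, by simp⟩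
    exact SimplyConnectedSpace.ofContractible _
  have hpre : {z : ℂ | h z.re < z.im} = e ⁻¹' {z : ℂ | 0 < z.im} := by
    ext z
    simp [e]
  rw [hpre]
  exact e.isSimplyConnected_preimage.2 hhalf

/-- If a compact subset of the closed upper half-plane avoids the real zeros of `f`, then it lies in
a simply connected region that contains no point on or below a real zero. -/
theorem exists_simplyConnected_above_zeros {f : ℂ → ℂ} (hf : Continuous f) {K : Set ℂ}
    (hK : IsCompact K) (hKim : ∀ z ∈ K, 0 ≤ z.im) (hKf : ∀ z ∈ K, f z ≠ 0) :
    ∃ G : Set ℂ, IsOpen G ∧ IsSimplyConnected G ∧ K ⊆ G ∧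
      ∀ x : ℝ, f x = 0 → ∀ y : ℝ, 0 ≤ y → (x : ℂ) - y * Complex.I ∉ G := by
  obtain ⟨b, hb⟩ := hK.isBounded.exists_norm_le
  -- A point outside `K` keeps `Z` nonempty.
  set Z : Set ℂ := (Complex.ofReal '' {x : ℝ | f x = 0}) ∪ {((|b| + 1 : ℝ) : ℂ)} with hZ
  have hZne : Z.Nonempty := ⟨_, Or.inr rfl⟩
  have hZcl : IsClosed Z := by
    refine IsClosed.union ?_ isClosed_singleton
    exact Complex.isometry_ofReal.isClosedEmbedding.isClosedMap _
      (isClosed_singleton.preimage (hf.comp Complex.continuous_ofReal))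
  have hdisj : Disjoint K Z := by
    rw [Set.disjoint_left]
    rintro z hz (⟨x, hx, rfl⟩ | h0)
    · exact hKf _ hz hx
    · have := hb z hz
      rw [h0, Complex.norm_real, Real.norm_eq_abs] at this
      linarith [le_abs_self b, le_abs_self (|b| + 1)]
  obtain ⟨ε, hε, hεd⟩ := Metric.exists_pos_forall_lt_edist hK hZcl hdisj
  set h : ℝ → ℝ := fun x => ε - Metric.infDist (x : ℂ) Z with hh
  have hhc : Continuous h :=
    continuous_const.sub ((Metric.continuous_infDist_pt Z).comp Complex.continuous_ofReal)
  refine ⟨{z | h z.re < z.im}, isOpen_lt (hhc.comp Complex.continuous_re) Complex.continuous_im,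
    isSimplyConnected_above_graph hhc, fun z hz => ?_, fun x hx y hy hmem => ?_⟩
  · have h1 : ∀ w ∈ Z, (ε : ℝ) < dist z w := by
      intro w hw
      have := hεd z hz w hw
      rw [edist_nndist] at this
      exact_mod_cast this
    have h2 : (ε : ℝ) < Metric.infDist z Z := by
      obtain ⟨w, hw, hwd⟩ := hZcl.exists_infDist_eq_dist hZne z
      rw [hwd]
      exact h1 w hw
    have h3 : Metric.infDist z Z ≤ Metric.infDist (z.re : ℂ) Z + dist z (z.re : ℂ) :=
      Metric.infDist_le_infDist_add_dist
    have h4 : dist z (z.re : ℂ) = z.im := by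
      have e : z - (z.re : ℂ) = z.im * Complex.I := by
        linear_combination -Complex.re_add_im z
      rw [dist_eq_norm, e, norm_mul, Complex.norm_I, mul_one, Complex.norm_real, Real.norm_eq_abs,
        abs_of_nonneg (hKim z hz)]
    simp only [Set.mem_ofPred_eq, hh]
    linarith
  · have h1 : (x : ℂ) ∈ Z := Or.inl ⟨x, hx, rfl⟩
    simp only [Set.mem_ofPred_eq, hh] at hmem
    have hε' : (0 : ℝ) < ε := hε
    simp [Metric.infDist_zero_of_mem h1] at hmem
    linarith

/-- The vertical rays that go down from the zeros join them to infinity. -/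
theorem zerosInUnboundedComponent_of_im_nonneg {f : ℂ → ℂ} (hf : ∀ z, f z = 0 → z.im = 0)
    {K : Set ℂ} (hKim : ∀ z ∈ K, 0 ≤ z.im) (hKf : ∀ z ∈ K, f z ≠ 0) :
    ZerosInUnboundedComponent f K := by
  intro w hw hbd
  set ray : Set ℂ := (fun y : ℝ => w - y * Complex.I) '' Set.Ici 0 with hray
  have hconn : IsPreconnected ray :=
    isPreconnected_Ici.image _ (by fun_prop)
  have hsub : ray ⊆ Kᶜ := by
    rintro _ ⟨y, hy, rfl⟩ hmem
    have h1 := hKim _ hmem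
    simp [hf w hw] at h1
    have hy0 : y = 0 := le_antisymm h1 hy
    refine hKf _ hmem ?_
    simpa [hy0] using hw
  have hwray : w ∈ ray := ⟨0, Set.self_mem_Ici, by simp⟩
  obtain ⟨C, hC⟩ := (hbd.subset (hconn.subset_connectedComponentIn hwray hsub)).exists_norm_le
  have h1 := hC _ ⟨|C| + 1, Set.mem_Ici.2 (by positivity), rfl⟩
  have h2 := Complex.abs_im_le_norm (w - ((|C| + 1 : ℝ) : ℂ) * Complex.I)
  have h3 : (w - ((|C| + 1 : ℝ) : ℂ) * Complex.I).im = -(|C| + 1) := by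
    simp [hf w hw]
  rw [h3, abs_neg, abs_of_pos (by positivity)] at h2
  linarith [le_abs_self C]

/-! ### The numerical conclusion and the theorem -/

/-- The estimates for the maximum modulus and for the argument at the two ends combine to the lower
bound for the change of the argument. Here `E = t ^ (a / 4)`, `X = log t`, `B = log M(t)`,
`D = log M(e ^ 2 * t) - B` and `K = log M(t ^ (1 + a)) - B`. -/
theorem le_sub_of_growth {E X a B D K v w : ℝ} (hE : 48 * Real.sqrt 2 / Real.pi ≤ E)
    (haE : 384 * Real.sqrt 2 / Real.pi ≤ a * E) (hX : 0 < X)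
    (hEX : Real.log E = a / 4 * X) (hB : 0 < B) (hBD : 2 * B / X ≤ D)
    (hv : 0.76 * v ≤ Real.pi * D)
    (hDK : D ≤ K * (4 / Real.pi * (Real.exp 1 / E ^ 2)))
    (hKw : B + K ≤ 9 * B + 15 * w) :
    Real.pi ^ 2 * E * B / (48 * Real.sqrt 2 * X) ≤ w - v := by
  have hpi := Real.pi_pos
  have hpi1 := Real.pi_gt_d2
  have hpi2 := Real.pi_lt_d2
  have hsq : (1.414 : ℝ) ≤ Real.sqrt 2 := Real.le_sqrt_of_sq_le (by norm_num)
  have he1 := Real.exp_one_gt_d9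
  have he2 := Real.exp_one_lt_d9
  have hE1 : 21.5 ≤ E := by
    refine le_trans ?_ hE
    rw [le_div_iff₀ hpi]
    linarith
  have hE0 : 0 < E := by linarith
  have haE1 : 172 ≤ a * E := by
    refine le_trans ?_ haE
    rw [le_div_iff₀ hpi]
    linarith
  have hD0 : 0 < D := lt_of_lt_of_le (by positivity) hBD
  have hBX : B ≤ D * X / 2 := by
    rw [div_le_iff₀ hX] at hBD
    linarith
  have hDE : 21.5 * (D * E) ≤ D * E ^ 2 := by
    have := mul_le_mul_of_nonneg_left hE1 (mul_nonneg hD0.le hE0.le)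
    nlinarith
  -- `log E ≤ E / e`, so `X = 4 * log E / a` is at most a small multiple of `E ^ 2`.
  have hlogE : Real.log E ≤ E / 2.7 := by
    have h1 := Real.log_le_sub_one_of_pos (show 0 < E / Real.exp 1 by positivity)
    rw [Real.log_div hE0.ne' (Real.exp_pos 1).ne', Real.log_exp] at h1
    have h2 : E / Real.exp 1 ≤ E / 2.7 := by
      gcongr
      linarith
    linarith
  have hXE : X ≤ E ^ 2 / 116 := by
    have h1 : 172 * X ≤ a * E * X := mul_le_mul_of_nonneg_right haE1 hX.le
    have h2 : a * E * X = 4 * (Real.log E * E) := by rw [hEX]; ring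
    have h3 : Real.log E * E ≤ E / 2.7 * E := mul_le_mul_of_nonneg_right hlogE hE0.le
    have h4 : 172 * X ≤ 4 * (E / 2.7 * E) := by linarith
    have h5 : 0 ≤ E ^ 2 := sq_nonneg E
    have h6 : 4 * (E / 2.7 * E) = E ^ 2 * (40 / 27) := by ring
    linarith
  have hBE : 8 * B ≤ D * E ^ 2 * 0.035 := by
    have := mul_le_mul_of_nonneg_left hXE hD0.le
    have h5 : 0 ≤ D * E ^ 2 := by positivity
    linarith
  have hK : D * E ^ 2 * 0.288 ≤ K := by
    have e : K * (4 / Real.pi * (Real.exp 1 / E ^ 2)) = K * 4 * Real.exp 1 / (Real.pi * E ^ 2) := by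
      field_simp
    rw [e, le_div_iff₀ (by positivity)] at hDK
    have h1 : D * E ^ 2 * 3.14 ≤ D * E ^ 2 * Real.pi := by gcongr
    have hK0 : 0 ≤ K := by
      by_contra! hneg
      have h2 : 0 < D * (Real.pi * E ^ 2) := by positivity
      have h3 : K * 4 * Real.exp 1 < 0 := by nlinarith
      linarith
    have h2 : K * Real.exp 1 ≤ K * 2.7183 := by
      gcongr
      linarith
    linarith
  have hv' : v ≤ 4.15 * D := by
    have : Real.pi * D ≤ 3.15 * D := by gcongr
    linarith
  have hV : Real.pi ^ 2 * E * B / (48 * Real.sqrt 2 * X) ≤ 0.0735 * (D * E) := by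
    rw [div_le_iff₀ (by positivity)]
    have h1 : Real.pi ^ 2 ≤ 3.15 ^ 2 := by gcongr
    calc Real.pi ^ 2 * E * B ≤ 3.15 ^ 2 * E * (D * X / 2) := by gcongr
      _ = 4.96125 * (D * E * X) := by ring
      _ ≤ 0.0735 * (D * E) * (48 * 1.414 * X) := by
        have : 0 ≤ D * E * X := by positivity
        linarith
      _ ≤ _ := by gcongr
  have hDE1 : 21.5 * D ≤ D * E := by
    have := mul_le_mul_of_nonneg_left hE1 hD0.le
    linarith
  linarith

theorem norm_le_maxModulus {f : ℂ → ℂ} (hf : Continuous f) (z : ℂ) :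
    ‖f z‖ ≤ maxModulus f ‖z‖ :=
  le_csSup ((isCompact_sphere 0 _).image hf.norm).bddAbove ⟨z, by simp, rfl⟩

theorem theorem2p1 (f : ℂ → ℂ) (hf : IsTranscendentalEntire f)
    (c : ℝ) (hc : c ≠ 0) (p₀ : ℕ) (p : ℕ → ℕ) (α : ℕ → ℝ)
    (hα_pos : ∀ n, 0 < α n) (hα_mono : StrictMono α)
    (hprod : HasProductForm f c p₀ p α)
    (R₁ : ℝ) (hR₁ : IsHadamardConstant f R₁)
    (t a : ℝ) (ht : 0 < t) (ha : 0 < a) (htR₁ : R₁ ≤ t)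
    (hta : 48 * Real.sqrt 2 / Real.pi ≤ t ^ (a / 4))
    (hata : 384 * Real.sqrt 2 / Real.pi ≤ a * t ^ (a / 4))
    (γ : Set ℂ) (hγ : IsContinuum γ) (hγ_im : ∀ z ∈ γ, 0 ≤ z.im)
    (hγ_inner : (γ ∩ Metric.sphere (0 : ℂ) t).Nonempty)
    (hγ_outer : (γ ∩ Metric.sphere (0 : ℂ) (t ^ (1 + a))).Nonempty)
    (hγ_f : ∀ z ∈ γ, 1 / maxModulus f t < ‖f z‖ ∧ ‖f z‖ < maxModulus f t) :
    ∃ Γ : Set ℂ, IsContinuum Γ ∧ Γ ⊆ γ ∩ closedAnnulus t (t ^ (1 + a)) ∧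
      ∃ z₀ ∈ Γ, ∃ z₀' ∈ Γ, ∃ δ : ℝ, HasNetArgChange f Γ z₀ z₀' δ ∧
        Real.pi ^ 2 * t ^ (a / 4) * Real.log (maxModulus f t) /
          (48 * Real.sqrt 2 * Real.log t) ≤ δ := by
  have hfc : Continuous f := hf.1.continuous
  have hpi := Real.pi_pos
  set E := t ^ (a / 4) with hE
  set R := t ^ (1 + a) with hR
  set m := maxModulus f t with hm
  have hE21 : 21 ≤ E := by
    refine le_trans ?_ hta
    have hsq : (1.414 : ℝ) ≤ Real.sqrt 2 := Real.le_sqrt_of_sq_le (by norm_num)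
    rw [le_div_iff₀ hpi]
    linarith [Real.pi_lt_d2]
  have ht1 : 1 < t := by
    by_contra! h
    have := Real.rpow_le_one ht.le h (show 0 ≤ a / 4 by positivity)
    linarith
  have hX : 0 < Real.log t := Real.log_pos ht1
  have hRE : R = t * E ^ 4 := by
    rw [hR, hE, Real.rpow_add ht, Real.rpow_one, ← Real.rpow_natCast, ← Real.rpow_mul ht.le]
    congr 2
    push_cast
    ring
  have hE4 : (21 : ℝ) ^ 4 ≤ E ^ 4 := pow_le_pow_left₀ (by norm_num) hE21 4
  have htR : 110 * t ≤ R := by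
    rw [hRE, mul_comm]
    exact mul_le_mul_of_nonneg_left (by linarith) ht.le
  have hR0 : 0 < R := by linarith
  have hm0 : 0 < m := hprod.maxModulus_pos hc hα_pos ht
  have hm1 : 1 < m := by
    obtain ⟨z, hz, -⟩ := hγ_inner
    have h1 := (hγ_f z hz).1.trans (hγ_f z hz).2
    rw [div_lt_iff₀ hm0] at h1
    nlinarith
  have hB : 0 < Real.log m := Real.log_pos hm1
  have hlogγ : ∀ z ∈ γ, f z ≠ 0 ∧ |Real.log ‖f z‖| ≤ Real.log m := by
    intro z hz
    obtain ⟨h1, h2⟩ := hγ_f z hz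
    have h0 : 0 < ‖f z‖ := lt_trans (by positivity) h1
    refine ⟨norm_pos_iff.1 h0, abs_le.2 ⟨?_, Real.log_le_log h0 h2.le⟩⟩
    have := Real.log_le_log (by positivity) h1.le
    rwa [one_div, Real.log_inv] at this
  -- A subcontinuum in the annulus that joins its boundary circles.
  obtain ⟨Γ, hΓ, hΓγ, hΓnorm, ⟨z₀, hz₀, hz₀t⟩, z₁, hz₁, hz₁R⟩ :=
    exists_continuum_between hγ continuous_norm (show t ≤ R by linarith)
      (hγ_inner.imp fun z hz => ⟨hz.1, by simpa using hz.2⟩)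
      (hγ_outer.imp fun z hz => ⟨hz.1, by simpa using hz.2⟩)
  have hcircle : ∀ ρ ∈ Set.Icc t R, ∃ z ∈ Γ, ‖z‖ = ρ := by
    intro ρ hρ
    have := hΓ.2.isPreconnected.intermediate_value hz₀ hz₁ continuous_norm.continuousOn
    rw [hz₀t, hz₁R] at this
    exact this hρ
  -- Growth of the maximum modulus from `t` to `e ^ 2 * t`, by the Hadamard property.
  have hq1 : (1 : ℝ) ≤ Real.log (Real.exp 2) := by rw [Real.log_exp]; norm_num
  have hexp2 : Real.exp 2 = Real.exp 1 ^ 2 := by rw [← Real.exp_nat_mul]; norm_num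
  have hq : (7.38 : ℝ) ≤ Real.exp 2 := by
    rw [hexp2]
    nlinarith [Real.exp_one_gt_d9]
  have hq' : Real.exp 2 ≤ 7.4 := by
    rw [hexp2]
    nlinarith [Real.exp_one_lt_d9, Real.exp_pos 1]
  set D := Real.log (maxModulus f (Real.exp 2 * t)) - Real.log m with hD
  set K := Real.log (maxModulus f R) - Real.log m with hK
  have hBD : 2 * Real.log m / Real.log t ≤ D := by
    have h1 := hR₁.2 t htR₁ (1 + 2 / Real.log t) (by linarith [div_pos two_pos hX])
    have h2 : t ^ (1 + 2 / Real.log t) = Real.exp 2 * t := by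
      rw [Real.rpow_add ht, Real.rpow_one, Real.rpow_def_of_pos ht, mul_div_cancel₀ _ hX.ne',
        mul_comm]
    rw [h2] at h1
    have h3 := Real.log_le_log (Real.rpow_pos_of_pos hm0 _) h1
    rw [Real.log_rpow hm0] at h3
    have h4 : (1 + 2 / Real.log t) * Real.log m =
      Real.log m + 2 * Real.log m / Real.log t := by ring
    linarith
  have hK0 : 0 ≤ K := by
    have h1 := Real.log_le_log (Real.rpow_pos_of_pos hm0 _)
      (hR₁.2 t htR₁ (1 + a) (by linarith))
    rw [Real.log_rpow hm0, ← hR] at h1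
    nlinarith
  have hMR : 0 < maxModulus f R := hprod.maxModulus_pos hc hα_pos hR0
  have hDK : D ≤ K * (4 / Real.pi * (Real.exp 1 / E ^ 2)) := by
    have h1 := norm_le_of_slit_annulus hf.1 (t := t) (R := R) (M := m) (K := K) ht hm0 hK0
      (fun z hz => by rw [hm, ← hz]; exact norm_le_maxModulus hfc z)
      (fun z hz => by
        rw [hK, Real.exp_sub, Real.exp_log hMR, Real.exp_log hm0, mul_div_cancel₀ _ hm0.ne', ← hz]
        exact norm_le_maxModulus hfc z)
      (fun ρ hρ => by
        obtain ⟨z, hz, hzρ⟩ := hcircle ρ hρ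
        rw [← hzρ]
        exact (hprod.norm_neg_le hα_pos z).trans_lt (hγ_f z (hΓγ hz)).2)
      (r := Real.exp 2 * t) (by nlinarith) (by nlinarith)
    have hqt : 0 < Real.exp 2 * t := by positivity
    have hsqrt : Real.sqrt (Real.exp 2 * t / R) = Real.exp 1 / E ^ 2 := by
      have e : Real.exp 2 * t / R = (Real.exp 1 / E ^ 2) ^ 2 := by
        rw [hRE, hexp2]
        field_simp
      rw [e, Real.sqrt_sq (by positivity)]
    rw [← hprod.maxModulus_eq hα_pos hqt.le, hsqrt] at h1
    have h2 := Real.log_le_log (hprod.maxModulus_pos hc hα_pos hqt) h1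
    rw [Real.log_mul hm0.ne' (Real.exp_pos _).ne', Real.log_exp] at h2
    linarith
  have hz₀0 : z₀ ≠ 0 := norm_pos_iff.1 (hz₀t ▸ ht)
  have hv := argSum_le_log_maxModulus_sub hc hα_pos hprod hz₀0 (hlogγ z₀ (hΓγ hz₀)).1
    (hγ_im z₀ (hΓγ hz₀)) hq hq1
  rw [hz₀t] at hv
  have hw := log_maxModulus_le hc hα_pos hprod ht htR hB.le hz₁R (hγ_im z₁ (hΓγ hz₁))
    (hlogγ z₁ (hΓγ hz₁)).1 (hlogγ z₁ (hΓγ hz₁)).2 fun ρ hρ => by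
      obtain ⟨z, hz, hzρ⟩ := hcircle ρ hρ
      obtain ⟨h1, h2⟩ := hlogγ z (hΓγ hz)
      exact ⟨z, hzρ, hγ_im z (hΓγ hz), h1, (le_abs_self _).trans h2⟩
  have hmain := le_sub_of_growth (w := argSum p₀ p α z₁) hta hata hX
    (by rw [hE, Real.log_rpow ht]) hB hBD hv hDK (by linarith)
  -- The region and the branch of `log f` that witness the change of the argument.
  have hreal : ∀ z, f z = 0 → z.im = 0 := fun z hz => (hprod.zero_real hc hα_pos hz).1
  have hΓim : ∀ z ∈ Γ, 0 ≤ z.im := fun z hz => hγ_im z (hΓγ hz)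
  have hΓf : ∀ z ∈ Γ, f z ≠ 0 := fun z hz => (hlogγ z (hΓγ hz)).1
  obtain ⟨G, hGo, hGs, hΓG, hG⟩ := exists_simplyConnected_above_zeros hfc hΓ.1 hΓim hΓf
  have hGf : ∀ z ∈ G, ∀ y : ℝ, 0 ≤ y → f (z + y * Complex.I) ≠ 0 := by
    intro z hz y hy h0
    have e : z + y * Complex.I = ((z + y * Complex.I).re : ℂ) :=
      Complex.ext (by simp) (by rw [hreal _ h0, Complex.ofReal_im])
    refine hG _ (e ▸ h0) y hy ?_
    rwa [← e, add_sub_cancel_right]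
  have him : ∀ z ∈ Γ, (logBranch c p₀ p α z).im = (Complex.log c).im + argSum p₀ p α z :=
    fun z hz => (hasSum_log_norm_and_arg hc hα_pos hprod
      (norm_pos_iff.1 (ht.trans_le (hΓnorm z hz).1)) (hΓf z hz) (hΓim z hz)).2.2
  refine ⟨Γ, hΓ, fun z hz => ⟨hΓγ hz, hΓnorm z hz⟩, z₀, hz₀, z₁, hz₁,
    argSum p₀ p α z₁ - argSum p₀ p α z₀, ⟨hz₀, hz₁, ?_, ?_, G, logBranch c p₀ p α, hGo, hGs, hΓG,
    fun z hz => ?_, fun z hz => ?_, fun z hz => ?_, ?_⟩, hmain⟩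
  · intro h
    rw [h, hz₁R] at hz₀t
    linarith
  · exact zerosInUnboundedComponent_of_im_nonneg hreal hΓim hΓf
  · simpa using hGf z hz 0 le_rfl
  · exact (differentiableAt_logBranch hc hα_pos hprod (hGf z hz)).differentiableWithinAt
  · exact exp_logBranch hc hα_pos hprod (by simpa using hGf z hz 0 le_rfl)
  · rw [him z₀ hz₀, him z₁ hz₁]
    ring
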